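/- All graphs are finite, simple and undirected. For a graph $G$ with at least two vertices let $\delta(G)$ be its minimum degree and let $\kappa(G)=\min_{x\neq y}\kappa_G(x,y)$ be its connectivity, where $\kappa_G(x,y)$ is the maximum number of pairwise internally disjoint paths between $x$ and $y$. For $S\subseteq V(H)$ with $|S|\ge 2$, an $S$-tree of a graph $H$ is a subgraph of $H$ that is a tree and whose vertex set contains $S$; two $S$-trees $T,T'$ are internally disjoint if $E(T)\cap E(T')=\varnothing$ and $V(T)\cap V(T')=S$; and $\kappa(S)$ is the maximum number of pairwise internally disjoint $S$-trees in $H$. For a graph $H$ with at least three vertices, the generalized $3$-connectivity is $\kappa_3(H)=\min\{\kappa(S) : S\subseteq V(H),\ |S|=3\}$. The total graph $T(G)$ has vertex set $V(G)\cup E(G)$ (a disjoint union), two of its vertices being adjacent if they are two adjacent vertices of $G$, two distinct edges of $G$ with a common endpoint, or a vertex of $G$ and an edge of $G$ incident with it. **Theorem.** For every connected graph $G$ with at least two vertices, $$\left\lfloor\frac{3\kappa(G)-1}{2}\right\rfloor\le\kappa_3(T(G))\le 2\delta(G).$$ -/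

import Mathlib

namespace TotalGraphConn

/-- The total graph of `G`: its vertices are the vertices and the edges of `G`; two of them are
adjacent when they are adjacent vertices of `G`, distinct edges of `G` with a common endpoint, or
a vertex and an edge of `G` that are incident. -/
def totalGraph {V : Type*} (G : SimpleGraph V) : SimpleGraph (V ⊕ G.edgeSet) where
  Adj
    | .inl u, .inl v => G.Adj u v
    | .inr e, .inr f => G.lineGraph.Adj e f
    | .inl u, .inr e => u ∈ (e : Sym2 V)
    | .inr e, .inl u => u ∈ (e : Sym2 V)
  symm := ⟨by
    rintro (u | e) (v | f) h
    · exact SimpleGraph.Adj.symm (G := G) h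
    · exact h
    · exact h
    · exact SimpleGraph.Adj.symm (G := G.lineGraph) h⟩
  loopless := ⟨by
    rintro (u | e) h
    · exact G.irrefl h
    · exact G.lineGraph.irrefl h⟩

/-- Two `x`-`y` paths are internally disjoint: they meet at most in their ends. -/
def PathsInternallyDisjoint {V : Type*} {G : SimpleGraph V} {x y : V} (p q : G.Path x y) : Prop :=
  ∀ v, v ∈ p.1.support → v ∈ q.1.support → v = x ∨ v = y

/-- `κ_G(x, y)`: the maximum number of (distinct) pairwise internally disjoint `x`-`y` paths.
On a finite vertex set there are finitely many paths, so the supremum is a maximum. -/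
noncomputable def localConnectivity {V : Type*} (G : SimpleGraph V) (x y : V) : ℕ :=
  sSup {m | ∃ P : Finset (G.Path x y),
    (P : Set (G.Path x y)).Pairwise PathsInternallyDisjoint ∧ P.card = m}

/-- The connectivity `κ(G) = min {κ_G(x, y) | x ≠ y}`, for graphs with at least two vertices. -/
noncomputable def connectivity {V : Type*} (G : SimpleGraph V) : ℕ :=
  sInf {m | ∃ x y : V, x ≠ y ∧ localConnectivity G x y = m}

/-- An `S`-Steiner tree of `G`: a subgraph of `G` that is a tree and contains `S`. -/
def IsSteinerTree {V : Type*} {G : SimpleGraph V} (S : Finset V) (T : G.Subgraph) : Prop :=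
  T.coe.IsTree ∧ (S : Set V) ⊆ T.verts

/-- Two `S`-Steiner trees are internally disjoint: they share no edge, and their common vertices
are exactly those of `S`. -/
def TreesInternallyDisjoint {V : Type*} {G : SimpleGraph V} (S : Finset V) (T T' : G.Subgraph) :
    Prop :=
  T.edgeSet ∩ T'.edgeSet = ∅ ∧ T.verts ∩ T'.verts = (S : Set V)

/-- `κ(S)`: the maximum number of pairwise internally disjoint `S`-Steiner trees in `G`.
On a finite vertex set there are finitely many subgraphs, so the supremum is a maximum. -/
noncomputable def generalizedLocalConnectivity {V : Type*} (G : SimpleGraph V) (S : Finset V) :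
    ℕ :=
  sSup {m | ∃ F : Finset G.Subgraph, (∀ T ∈ F, IsSteinerTree S T) ∧
    (F : Set G.Subgraph).Pairwise (TreesInternallyDisjoint S) ∧ F.card = m}

/-- The generalized `k`-connectivity `κ_k(G) = min {κ(S) | S ⊆ V(G), |S| = k}`, for `2 ≤ k` and
graphs with at least `k` vertices. -/
noncomputable def generalizedConnectivity {V : Type*} (k : ℕ) (G : SimpleGraph V) : ℕ :=
  sInf {m | ∃ S : Finset V, S.card = k ∧ generalizedLocalConnectivity G S = m}

end TotalGraphConn

/-! The upper bound counts edges at one terminal: internally disjoint trees through a vertex `v` of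
minimum degree use different edges at `v`, and `v` has degree 2 deg(v) in the total graph.

For the lower bound put k = κ(G). No fewer than 2k vertices separate the total graph
(`totalGraph_noSmallSeparator`). If fewer than k edges of G are removed, the remaining edges still
connect G. Otherwise fewer than k vertices are removed, the remaining ones are connected, and each
remaining edge is linked to one of them.

For terminals x, y, z Menger's theorem then gives N = 2k - 1 internally disjoint x-y paths P that
avoid z and as many z-x paths Q that avoid y. Follow each Q from z and stop it so that every
stopping point (foot) is the first or the last foot on some P (`exists_stopping`). Each P then
carries at most two feet. With one foot, P and the leg from z form a tree. With no foot, P connects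
x and y. With two feet, the ends of P give an x-z connector and a y-z connector. A Q that never
stops is an x-z connector.

Let c of the P carry two feet and q of the Q never stop. As there are equally many P and Q, c + q of
the P carry no foot. Any two connectors of different kinds form a tree, so the connectors yield q +
⌊3c/2⌋ trees. Together with the N - 2c - q trees from single feet these are N - ⌈c/2⌉ trees. Since
2c ≤ N, this is at least ⌊(3k - 1)/2⌋. -/

namespace TotalGraphConn

/-! ### Menger's theorem for finite digraphs, by induction on the number of arcs -/

section Menger

/-- `l` is the vertex list of a walk from `A` to `B` along the arcs in `E`. -/
def IsLinkList {V : Type*} (E : Finset (V × V)) (A B : Finset V) (l : List V) : Prop :=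
  (∃ a ∈ A, l.head? = some a) ∧ (∃ b ∈ B, l.getLast? = some b) ∧
    l.IsChain (fun a b => (a, b) ∈ E)

/-- Every walk from `A` to `B` along arcs in `E` meets `X`. -/
def Separates {V : Type*} (E : Finset (V × V)) (A B X : Finset V) : Prop :=
  ∀ l, IsLinkList E A B l → ∃ v ∈ l, v ∈ X

theorem exists_first_mem {V : Type*} {l : List V} {X : Finset V} (h : ∃ v ∈ l, v ∈ X) :
    ∃ l₁ w l₂, l = l₁ ++ w :: l₂ ∧ w ∈ X ∧ ∀ v ∈ l₁, v ∉ X := by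
  classical
  induction l with
  | nil => simp at h
  | cons a l ih =>
    by_cases ha : a ∈ X
    · exact ⟨[], a, l, rfl, ha, by simp⟩
    · obtain ⟨v, hv, hvX⟩ := h
      have hvl : v ∈ l := by
        rcases List.mem_cons.1 hv with rfl | h
        · exact absurd hvX ha
        · exact h
      obtain ⟨l₁, w, l₂, rfl, hw, h1⟩ := ih ⟨v, hvl, hvX⟩
      refine ⟨a :: l₁, w, l₂, rfl, hw, ?_⟩
      intro u hu
      rcases List.mem_cons.1 hu with rfl | h
      · exact ha
      · exact h1 u h

theorem exists_last_mem {V : Type*} {l : List V} {X : Finset V} (h : ∃ v ∈ l, v ∈ X) :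
    ∃ l₁ w l₂, l = l₁ ++ w :: l₂ ∧ w ∈ X ∧ ∀ v ∈ l₂, v ∉ X := by
  obtain ⟨l₁, w, l₂, h, hw, h1⟩ := exists_first_mem (l := l.reverse) (X := X) (by simpa using h)
  refine ⟨l₂.reverse, w, l₁.reverse, ?_, hw, by simpa using h1⟩
  have := congrArg List.reverse h
  simpa using this

theorem IsLinkList.mono {V : Type*} {E E' : Finset (V × V)} {A B : Finset V} {l : List V}
    (h : E ⊆ E')
    (hl : IsLinkList E A B l) : IsLinkList E' A B l :=
  ⟨hl.1, hl.2.1, hl.2.2.imp fun _ _ hab => h hab⟩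

variable {V : Type*} [DecidableEq V]

/-- Every arc of the walk starts at a vertex other than the last, so an arc with tail `x` is not
used even if `w = x`. -/
theorem isChain_erase_of_left {E : Finset (V × V)} {x y : V} {l : List V} {w : V}
    (h : (l ++ [w]).IsChain (fun a b => (a, b) ∈ E)) (hx : x ∉ l) :
    (l ++ [w]).IsChain (fun a b => (a, b) ∈ E.erase (x, y)) := by
  induction l with
  | nil => simp
  | cons a l ih =>
    simp only [List.mem_cons, not_or] at hx
    rw [List.cons_append, List.isChain_cons] at h ⊢
    refine ⟨fun b hb => Finset.mem_erase.2 ⟨?_, h.1 b hb⟩, ih h.2 hx.2⟩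
    rintro he
    exact hx.1 (congrArg Prod.fst he).symm

theorem isChain_erase_of_right {E : Finset (V × V)} {x y : V} {l : List V} {w : V}
    (h : (w :: l).IsChain (fun a b => (a, b) ∈ E)) (hy : y ∉ l) :
    (w :: l).IsChain (fun a b => (a, b) ∈ E.erase (x, y)) := by
  induction l generalizing w with
  | nil => simp
  | cons a l ih =>
    simp only [List.mem_cons, not_or] at hy
    rw [List.isChain_cons_cons] at h ⊢
    refine ⟨Finset.mem_erase.2 ⟨?_, h.1⟩, ih h.2 hy.2⟩
    rintro he
    exact hy.1 (congrArg Prod.snd he).symm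

theorem Separates.insert_left {E : Finset (V × V)} {A B S : Finset V} {x y : V}
    (h : Separates (E.erase (x, y)) A B S) : Separates E A B (insert x S) := by
  intro l hl
  by_cases hx : x ∈ l
  · exact ⟨x, hx, by simp⟩
  · obtain ⟨b, hb, hlast⟩ := hl.2.1
    have hne : l ≠ [] := by rintro rfl; simp at hlast
    have hc : l.IsChain (fun a b => (a, b) ∈ E.erase (x, y)) := by
      rw [← List.dropLast_append_getLast hne]
      refine isChain_erase_of_left ?_ fun h => hx (List.dropLast_subset _ h)
      rw [List.dropLast_append_getLast hne]
      exact hl.2.2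
    obtain ⟨v, hv, hvS⟩ := h l ⟨hl.1, hl.2.1, hc⟩
    exact ⟨v, hv, by simp [hvS]⟩

theorem Separates.insert_right {E : Finset (V × V)} {A B S : Finset V} {x y : V}
    (h : Separates (E.erase (x, y)) A B S) : Separates E A B (insert y S) := by
  intro l hl
  by_cases hy : y ∈ l
  · exact ⟨y, hy, by simp⟩
  · have hc : l.IsChain (fun a b => (a, b) ∈ E.erase (x, y)) := by
      cases l with
      | nil => simp
      | cons a l => exact isChain_erase_of_right hl.2.2 fun h => hy (by simp [h])
    obtain ⟨v, hv, hvS⟩ := h l ⟨hl.1, hl.2.1, hc⟩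
    exact ⟨v, hv, by simp [hvS]⟩

/-- Cut an `A`-`B` walk at its first vertex in `X`. The initial piece does not use the arc `(x, y)`,
since `x ∈ X` could only be its last vertex. -/
theorem Separates.of_left {E : Finset (V × V)} {A B X W : Finset V} {x y : V} (hx : x ∈ X)
    (hX : Separates E A B X) (hW : Separates (E.erase (x, y)) A X W) : Separates E A B W := by
  intro l hl
  obtain ⟨l₁, w, l₂, rfl, hw, h1⟩ := exists_first_mem (hX l hl)
  have hlink : IsLinkList (E.erase (x, y)) A X (l₁ ++ [w]) := by
    refine ⟨?_, ⟨w, hw, by simp⟩, ?_⟩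
    · obtain ⟨a, ha, hh⟩ := hl.1
      refine ⟨a, ha, ?_⟩
      cases l₁ <;> simpa using hh
    · refine isChain_erase_of_left ?_ fun h => h1 x h hx
      have := hl.2.2
      rw [List.isChain_split] at this
      exact this.1
  obtain ⟨v, hv, hvW⟩ := hW _ hlink
  refine ⟨v, ?_, hvW⟩
  simp only [List.mem_append, List.mem_cons, List.not_mem_nil, or_false] at hv ⊢
  tauto

theorem Separates.of_right {E : Finset (V × V)} {A B Y W : Finset V} {x y : V} (hy : y ∈ Y)
    (hY : Separates E A B Y) (hW : Separates (E.erase (x, y)) Y B W) : Separates E A B W := by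
  intro l hl
  obtain ⟨l₁, w, l₂, rfl, hw, h1⟩ := exists_last_mem (hY l hl)
  have hlink : IsLinkList (E.erase (x, y)) Y B (w :: l₂) := by
    refine ⟨⟨w, hw, by simp⟩, ?_, ?_⟩
    · obtain ⟨b, hb, hh⟩ := hl.2.1
      refine ⟨b, hb, ?_⟩
      simpa [List.getLast?_append] using hh
    · refine isChain_erase_of_right ?_ fun h => h1 y h hy
      have := hl.2.2
      rw [List.isChain_split] at this
      exact this.2
  obtain ⟨v, hv, hvW⟩ := hW _ hlink
  exact ⟨v, List.mem_append_right _ hv, hvW⟩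

/-- `k` pairwise disjoint paths from `A` to `B`. -/
def HasLinkage (E : Finset (V × V)) (A B : Finset V) (k : ℕ) : Prop :=
  ∃ P : Fin k → List V, (∀ i, IsLinkList E A B (P i) ∧ (P i).Nodup) ∧
    ∀ i j v, v ∈ P i → v ∈ P j → i = j

/-- The `k` disjoint paths have `k` different ends in `X`, which exhaust `X`; so no path meets `X`
before its end. -/
theorem linkage_last {E : Finset (V × V)} {A X : Finset V} {k : ℕ} (hX : X.card = k)
    {P : Fin k → List V} (hP : ∀ i, IsLinkList E A X (P i))
    (hd : ∀ i j v, v ∈ P i → v ∈ P j → i = j) :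
    ∃ s : Fin k → V, Function.Injective s ∧ (∀ v, v ∈ X ↔ ∃ i, s i = v) ∧
      (∀ i, (P i).getLast? = some (s i)) ∧ ∀ i v, v ∈ P i → v ∈ X → v = s i := by
  choose s hsX hs using fun i => (hP i).2.1
  have hmem : ∀ i, s i ∈ P i := fun i => List.mem_of_getLast? (hs i)
  have hinj : Function.Injective s := fun i j hij => hd i j (s i) (hmem i) (hij ▸ hmem j)
  have himg : Finset.univ.image s = X := by
    apply Finset.eq_of_subset_of_card_le
    · intro v hv
      obtain ⟨i, -, rfl⟩ := Finset.mem_image.1 hv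
      exact hsX i
    · rw [Finset.card_image_of_injective _ hinj, hX]; simp
  have hiff : ∀ v, v ∈ X ↔ ∃ i, s i = v := by
    intro v; rw [← himg]; simp
  refine ⟨s, hinj, hiff, hs, ?_⟩
  intro i v hv hvX
  obtain ⟨j, rfl⟩ := (hiff v).1 hvX
  rw [hd i j _ hv (hmem j)]

theorem IsLinkList.reverse {E : Finset (V × V)} {A B : Finset V} {l : List V}
    (h : IsLinkList E A B l) : IsLinkList (E.image Prod.swap) B A l.reverse := by
  refine ⟨?_, ?_, ?_⟩
  · simpa [List.head?_reverse] using h.2.1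
  · simpa [List.getLast?_reverse] using h.1
  · rw [List.isChain_reverse]
    refine h.2.2.imp fun a b hab => ?_
    exact Finset.mem_image.2 ⟨(a, b), hab, rfl⟩

theorem linkage_head {E : Finset (V × V)} {B Y : Finset V} {k : ℕ} (hY : Y.card = k)
    {Q : Fin k → List V} (hQ : ∀ i, IsLinkList E Y B (Q i))
    (hd : ∀ i j v, v ∈ Q i → v ∈ Q j → i = j) :
    ∃ s : Fin k → V, Function.Injective s ∧ (∀ v, v ∈ Y ↔ ∃ i, s i = v) ∧
      (∀ i, (Q i).head? = some (s i)) ∧ ∀ i v, v ∈ Q i → v ∈ Y → v = s i := by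
  obtain ⟨s, h1, h2, h3, h4⟩ := linkage_last hY (P := fun i => (Q i).reverse)
    (fun i => (hQ i).reverse) (by simpa using hd)
  exact ⟨s, h1, h2, by simpa [List.getLast?_reverse] using h3, by simpa using h4⟩

/-- Two linkages that meet along `S`, one ending in `S ∪ {x}` and one starting in `S ∪ {y}`, are
joined by the arc `(x, y)`. -/
theorem HasLinkage.glue {E : Finset (V × V)} {A B S : Finset V} {x y : V} {k : ℕ}
    (hxy : (x, y) ∈ E) (hS : Separates (E.erase (x, y)) A B S)
    (hxS : x ∉ S) (hyS : y ∉ S) (hk : S.card + 1 = k)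
    (hP : HasLinkage (E.erase (x, y)) A (insert x S) k)
    (hQ : HasLinkage (E.erase (x, y)) (insert y S) B k) : HasLinkage E A B k := by
  obtain ⟨P, hP, hPd⟩ := hP
  obtain ⟨Q, hQ, hQd⟩ := hQ
  obtain ⟨s, hs, hsX, hlast, hPX⟩ := linkage_last (by rw [Finset.card_insert_of_notMem hxS, hk])
    (fun i => (hP i).1) hPd
  obtain ⟨s', hs', hsY, hhead, hQY⟩ := linkage_head (by rw [Finset.card_insert_of_notMem hyS, hk])
    (fun i => (hQ i).1) hQd
  have hsplitP : ∀ i, ∃ p, P i = p ++ [s i] := by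
    intro i
    obtain ⟨p, hp⟩ := List.getLast?_eq_some_iff.1 (hlast i)
    exact ⟨p, hp⟩
  have hsplitQ : ∀ i, ∃ q, Q i = s' i :: q := by
    intro i
    obtain ⟨q, hq⟩ := List.head?_eq_some_iff.1 (hhead i)
    exact ⟨q, hq⟩
  choose p hp using hsplitP
  choose q hq using hsplitQ
  -- Going along `P i` to `v` and on along `Q j` is an `A`-`B` walk without the arc `(x, y)`, so it
  -- meets `S`. Neither part can meet `S` away from `v`, since `P i` does so only in its last vertex
  -- and `Q j` only in its first.
  have cross : ∀ i j v, v ∈ P i → v ∈ Q j → v ∈ S ∧ v = s i ∧ v = s' j := by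
    intro i j v hvP hvQ
    obtain ⟨a₁, a₂, ha⟩ := List.append_of_mem hvP
    obtain ⟨b₁, b₂, hb⟩ := List.append_of_mem hvQ
    have hcP := (hP i).1.2.2
    have hcQ := (hQ j).1.2.2
    rw [ha, List.isChain_split] at hcP
    rw [hb, List.isChain_split] at hcQ
    have hlink : IsLinkList (E.erase (x, y)) A B (a₁ ++ v :: b₂) := by
      refine ⟨?_, ?_, ?_⟩
      · obtain ⟨a, haA, hh⟩ := (hP i).1.1
        refine ⟨a, haA, ?_⟩
        rw [ha] at hh
        cases a₁ <;> simpa using hh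
      · obtain ⟨b, hbB, hh⟩ := (hQ j).1.2.1
        refine ⟨b, hbB, ?_⟩
        rw [hb] at hh
        simpa [List.getLast?_append] using hh
      · rw [List.isChain_split]
        exact ⟨hcP.1, hcQ.2⟩
    obtain ⟨u, hu, huS⟩ := hS _ hlink
    · rw [List.mem_append] at hu
      have key : v ∈ S → v ∈ S ∧ v = s i ∧ v = s' j := fun h =>
        ⟨h, hPX i v hvP (by simp [h]), hQY j v hvQ (by simp [h])⟩
      rcases hu with hu | hu
      · have hus : u = s i := hPX i u (by rw [ha]; simp [hu]) (by simp [huS])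
        have hnd := (hP i).2
        have hl := hlast i
        rw [ha] at hnd hl
        have h2 : s i ∈ v :: a₂ := by
          rw [List.getLast?_append] at hl
          apply List.mem_of_getLast?
          simpa [List.getLast?_cons] using hl
        exact absurd (hus ▸ h2) fun h => (List.nodup_append.1 hnd).2.2 u hu u h rfl
      · rcases List.mem_cons.1 hu with rfl | hu
        · exact key huS
        · have hus : u = s' j := hQY j u (by rw [hb]; simp [hu]) (by simp [huS])
          have hnd := (hQ j).2
          have hl := hhead j
          rw [hb] at hnd hl
          have h2 : s' j ∈ b₁ ++ [v] := by
            cases b₁ <;> simp at hl <;> simp [hl]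
          rw [show b₁ ++ v :: b₂ = (b₁ ++ [v]) ++ b₂ by simp] at hnd
          exact absurd (hus ▸ h2) fun h => (List.nodup_append.1 hnd).2.2 u h u hu rfl
  -- The path ending in `x` is continued by the one starting in `y`; every other path by the one
  -- starting where it ends.
  have hτ : ∀ i, ∃ j, s' j = if s i = x then y else s i := by
    intro i
    refine (hsY _).1 ?_
    have := (hsX (s i)).2 ⟨i, rfl⟩
    split_ifs with h
    · simp
    · simp only [Finset.mem_insert] at this ⊢
      exact Or.inr (this.resolve_left h)
  choose τ hτ using hτ
  have hsy : ∀ i, s i ≠ x → s i ∈ S := fun i h =>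
    (Finset.mem_insert.1 ((hsX (s i)).2 ⟨i, rfl⟩)).resolve_left h
  have hτinj : Function.Injective τ := by
    intro i j hij
    have h1 := hτ i
    rw [hij, hτ j] at h1
    apply hs
    split_ifs at h1 with h2 h3 h3
    · rw [h2, h3]
    · exact absurd (hsy i h3) (h1 ▸ hyS)
    · exact absurd (hsy j h2) (h1 ▸ hyS)
    · exact h1.symm
  -- Unless the arc `(x, y)` joins the two paths, their common vertex must not be listed twice.
  let R : Fin k → List V := fun i => P i ++ (if s i = x then Q (τ i) else q (τ i))
  have hR : ∀ i v, v ∈ R i → v ∈ P i ∨ v ∈ Q (τ i) := by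
    intro i v hv
    rcases List.mem_append.1 hv with h | h
    · exact Or.inl h
    · right
      split_ifs at h
      · exact h
      · rw [hq]; simp [h]
  have hmix : ∀ i j v, v ∈ P i → v ∈ Q (τ j) → i = j := by
    intro i j v h1 h2
    obtain ⟨h3, h4, h5⟩ := cross i (τ j) v h1 h2
    have hix : s i ≠ x := fun h => hxS (h ▸ h4 ▸ h3)
    rw [hτ j] at h5
    split_ifs at h5 with h6
    · exact absurd h3 (h5 ▸ hyS)
    · exact hs (h4.symm.trans h5)
  refine ⟨R, fun i => ⟨⟨?_, ?_, ?_⟩, ?_⟩, ?_⟩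
  · obtain ⟨a, haA, hh⟩ := (hP i).1.1
    exact ⟨a, haA, by simp [R, List.head?_append, hh]⟩
  · obtain ⟨b, hbB, hh⟩ := (hQ (τ i)).1.2.1
    refine ⟨b, hbB, ?_⟩
    simp only [R]
    split_ifs with h
    · simp [List.getLast?_append, hh]
    · rw [hq, hτ, if_neg h] at hh
      rw [List.getLast?_append, hlast i]
      rw [List.getLast?_cons] at hh
      cases hqq : (q (τ i)).getLast? <;> rw [hqq] at hh <;> simpa using hh
  · have hcP := (hP i).1.2.2
    have hcQ := (hQ (τ i)).1.2.2
    have hmono : ∀ a b, (a, b) ∈ E.erase (x, y) → (a, b) ∈ E := fun a b h =>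
      Finset.mem_of_mem_erase h
    have hcP' := hcP.imp hmono
    have hcQ' := hcQ.imp hmono
    simp only [R]
    split_ifs with h
    · rw [List.isChain_append]
      refine ⟨hcP', hcQ', ?_⟩
      intro a ha b hb
      rw [hlast i] at ha
      rw [hhead] at hb
      simp only [Option.mem_some_iff] at ha hb
      rw [← ha, ← hb, hτ i, if_pos h, h]
      exact hxy
    · rw [hp i] at hcP' ⊢
      rw [hq, hτ i, if_neg h] at hcQ'
      rw [List.append_assoc]
      exact List.isChain_split.2 ⟨hcP', hcQ'⟩
  · simp only [R]
    rw [List.nodup_append]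
    refine ⟨(hP i).2, ?_, ?_⟩
    · split_ifs with h
      · exact (hQ _).2
      · have := (hQ (τ i)).2
        rw [hq] at this
        exact this.of_cons
    · rintro a ha b hb rfl
      split_ifs at hb with h
      · obtain ⟨h3, h4, -⟩ := cross i (τ i) a ha hb
        exact hxS (h ▸ h4 ▸ h3)
      · obtain ⟨h3, h4, h5⟩ := cross i (τ i) a ha (by rw [hq]; simp [hb])
        have := (hQ (τ i)).2
        rw [hq, List.nodup_cons] at this
        exact this.1 (h5 ▸ hb)
  · intro i j v hi hj
    rcases hR i v hi with h1 | h1 <;> rcases hR j v hj with h2 | h2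
    · exact hPd i j v h1 h2
    · exact hmix i j v h1 h2
    · exact (hmix j i v h2 h1).symm
    · exact hτinj (hQd _ _ v h1 h2)

/-- **Menger's theorem** for disjoint paths between two vertex sets of a finite digraph. -/
theorem menger (E : Finset (V × V)) (A B : Finset V) (k : ℕ)
    (h : ∀ X : Finset V, Separates E A B X → k ≤ X.card) : HasLinkage E A B k := by
  induction hn : E.card generalizing E A B with
  | zero =>
    obtain rfl := Finset.card_eq_zero.1 hn
    -- Without arcs, walks are single vertices.
    have hsep : Separates (∅ : Finset (V × V)) A B (A ∩ B) := by
      rintro l ⟨⟨a, ha, hh⟩, ⟨b, hb, hl⟩, hc⟩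
      match l, hh, hl, hc with
      | [c], hh, hl, _ =>
        simp at hh hl
        subst hh hl
        exact ⟨c, by simp, by simp [ha, hb]⟩
      | c :: d :: l, _, _, hc => simp at hc
    obtain ⟨f⟩ : Nonempty (Fin k ↪ (A ∩ B : Finset V)) := by
      apply Function.Embedding.nonempty_of_card_le
      simpa using h _ hsep
    refine ⟨fun i => [(f i : V)], fun i => ⟨⟨⟨f i, ?_, rfl⟩, ⟨f i, ?_, rfl⟩, by simp⟩, by simp⟩, ?_⟩
    · exact (Finset.mem_inter.1 (f i).2).1
    · exact (Finset.mem_inter.1 (f i).2).2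
    · intro i j v hi hj
      simp only [List.mem_singleton] at hi hj
      exact f.injective (Subtype.ext (hi.symm.trans hj))
  | succ n ih =>
    obtain ⟨⟨x, y⟩, hxy⟩ : E.Nonempty := Finset.card_pos.1 (by omega)
    have hcard : (E.erase (x, y)).card = n := by rw [Finset.card_erase_of_mem hxy, hn]; rfl
    by_cases hk : ∀ X : Finset V, Separates (E.erase (x, y)) A B X → k ≤ X.card
    · obtain ⟨P, hP, hd⟩ := ih _ A B hk hcard
      exact ⟨P, fun i => ⟨(hP i).1.mono (Finset.erase_subset _ _), (hP i).2⟩, hd⟩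
    · push Not at hk
      obtain ⟨S, hS, hlt⟩ := hk
      -- Both `S ∪ {x}` and `S ∪ {y}` separate in `E`, so `S` has exactly `k - 1` vertices and
      -- contains neither `x` nor `y`.
      have hX := h _ hS.insert_left
      have hY := h _ hS.insert_right
      have hxS : x ∉ S := fun hx => by rw [Finset.insert_eq_of_mem hx] at hX; omega
      have hyS : y ∉ S := fun hy => by rw [Finset.insert_eq_of_mem hy] at hY; omega
      have hc := Finset.card_insert_of_notMem hxS
      refine HasLinkage.glue hxy hS hxS hyS (by omega) ?_ ?_
      · exact ih _ _ _ (fun W hW => h W (hS.insert_left.of_left (by simp) hW)) hcard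
      · exact ih _ _ _ (fun W hW => h W (hS.insert_right.of_right (by simp) hW)) hcard

end Menger

/-! ### Stopping one family of paths at extremal points of another -/

section Feet

variable {V : Type*} {N : ℕ} (P Q : Fin N → List V)

/-- The vertex at which the `j`-th list stops at position `t j`, if it has not run to its end. -/
def foot (t : Fin N → ℕ) (j : Fin N) : Option V := (Q j)[t j]?

theorem foot_mem {t : Fin N → ℕ} {j : Fin N} {v : V} (h : foot Q t j = some v) : v ∈ Q j :=
  List.mem_of_getElem? h

/-- The lists that run to their end. -/
def freeLists (t : Fin N → ℕ) : Finset (Fin N) := {j | foot Q t j = none}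

theorem mem_freeLists {Q : Fin N → List V} {t : Fin N → ℕ} {j : Fin N} :
    j ∈ freeLists Q t ↔ foot Q t j = none := by
  simp [freeLists]

variable [DecidableEq V]

/-- `v` comes weakly before all feet on the `i`-th list. -/
def BeforeFeet (t : Fin N → ℕ) (i : Fin N) (v : V) : Prop :=
  ∀ j w, foot Q t j = some w → w ∈ P i → (P i).idxOf v ≤ (P i).idxOf w

/-- `v` comes weakly after all feet on the `i`-th list. -/
def AfterFeet (t : Fin N → ℕ) (i : Fin N) (v : V) : Prop :=
  ∀ j w, foot Q t j = some w → w ∈ P i → (P i).idxOf w ≤ (P i).idxOf v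

/-- All vertices passed before the stopping positions that are on a list `P i` lie strictly between
two feet on that list. -/
def PassedBetween (t : Fin N → ℕ) : Prop :=
  ∀ j s v i, s < t j → (Q j)[s]? = some v → v ∈ P i →
    ¬ BeforeFeet P Q t i v ∧ ¬ AfterFeet P Q t i v

variable {P Q} in
-- A foot that is not extremal can be passed: where it lies on a `P i`, it is strictly between two
-- other feet, which stay. So the interval spanned by the feet does not shrink, and a new foot can
-- only widen it.
theorem PassedBetween.advance {t : Fin N → ℕ} (h : PassedBetween P Q t) {j : Fin N} {v : V}
    (hv : foot Q t j = some v)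
    (hmid : ∀ i, v ∈ P i → ¬ BeforeFeet P Q t i v ∧ ¬ AfterFeet P Q t i v) :
    PassedBetween P Q (Function.update t j (t j + 1)) := by
  have old : ∀ j' w, foot Q t j' = some w → w ≠ v →
      foot Q (Function.update t j (t j + 1)) j' = some w := by
    intro j' w hw hne
    have : j' ≠ j := by
      rintro rfl
      rw [hv] at hw
      exact hne (Option.some.inj hw).symm
    simpa [foot, Function.update_of_ne this] using hw
  have before : ∀ i u, u ∈ P i → ¬ BeforeFeet P Q t i u →
      ¬ BeforeFeet P Q (Function.update t j (t j + 1)) i u := by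
    intro i u hu hn hb
    apply hn
    intro j' w hw hwi
    by_cases hwv : w = v
    · subst hwv
      have h1 := (hmid i hwi).1
      simp only [BeforeFeet, not_forall, not_le] at h1
      obtain ⟨j₂, w₂, hw₂, hw₂i, hlt⟩ := h1
      have := hb j₂ w₂ (old _ _ hw₂ (by rintro rfl; omega)) hw₂i
      omega
    · exact hb j' w (old _ _ hw hwv) hwi
  have after : ∀ i u, u ∈ P i → ¬ AfterFeet P Q t i u →
      ¬ AfterFeet P Q (Function.update t j (t j + 1)) i u := by
    intro i u hu hn hb
    apply hn
    intro j' w hw hwi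
    by_cases hwv : w = v
    · subst hwv
      have h1 := (hmid i hwi).2
      simp only [AfterFeet, not_forall, not_le] at h1
      obtain ⟨j₂, w₂, hw₂, hw₂i, hlt⟩ := h1
      have := hb j₂ w₂ (old _ _ hw₂ (by rintro rfl; omega)) hw₂i
      omega
    · exact hb j' w (old _ _ hw hwv) hwi
  intro j' s u i hs hsu hui
  have key : ¬ BeforeFeet P Q t i u ∧ ¬ AfterFeet P Q t i u := by
    by_cases hj : j' = j
    · subst hj
      rw [Function.update_self] at hs
      rcases Nat.lt_succ_iff_lt_or_eq.1 hs with hs | rfl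
      · exact h j' s u i hs hsu hui
      · have : u = v := Option.some.inj (hsu.symm.trans hv)
        subst this
        exact hmid i hui
    · rw [Function.update_of_ne hj] at hs
      exact h j' s u i hs hsu hui
  exact ⟨before i u hui key.1, after i u hui key.2⟩

/-- One can stop the lists `Q j` so that each foot is extremal among the feet on a list `P i`, and
no vertex passed before lies outside the interval spanned by the feet. -/
theorem exists_stopping : ∃ t : Fin N → ℕ, PassedBetween P Q t ∧
    ∀ j v, foot Q t j = some v → ∃ i, v ∈ P i ∧ (BeforeFeet P Q t i v ∨ AfterFeet P Q t i v) := by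
  -- As long as some foot is not extremal on any list, advance it; the total length still ahead
  -- decreases.
  suffices H : ∀ n (t : Fin N → ℕ), PassedBetween P Q t → (∑ j, ((Q j).length - t j)) = n →
      ∃ t : Fin N → ℕ, PassedBetween P Q t ∧
        ∀ j v, foot Q t j = some v →
          ∃ i, v ∈ P i ∧ (BeforeFeet P Q t i v ∨ AfterFeet P Q t i v) from
    H _ (fun _ => 0) (fun j s v i hs => by simp at hs) rfl
  intro n
  induction n using Nat.strong_induction_on with
  | _ n ih =>
    intro t ht hn
    by_cases hterm : ∀ j v, foot Q t j = some v →
          ∃ i, v ∈ P i ∧ (BeforeFeet P Q t i v ∨ AfterFeet P Q t i v)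
    · exact ⟨t, ht, hterm⟩
    · push Not at hterm
      obtain ⟨j, v, hv, hmid⟩ := hterm
      refine ih _ ?_ _ (ht.advance hv hmid) rfl
      rw [← hn]
      have hlt : t j < (Q j).length := by
        by_contra hcon
        rw [foot, List.getElem?_eq_none (by omega)] at hv
        simp at hv
      apply Finset.sum_lt_sum
      · intro j' _
        by_cases hj : j' = j
        · subst hj; rw [Function.update_self]; omega
        · rw [Function.update_of_ne hj]
      · refine ⟨j, Finset.mem_univ _, ?_⟩
        rw [Function.update_self]; omega

/-- The lists whose foot is on `P i`. -/
def feetOn (t : Fin N → ℕ) (i : Fin N) : Finset (Fin N) :=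
  {j | ∃ v, foot Q t j = some v ∧ v ∈ P i}

variable {P Q}

theorem mem_feetOn {t : Fin N → ℕ} {i j : Fin N} :
    j ∈ feetOn P Q t i ↔ ∃ v, foot Q t j = some v ∧ v ∈ P i := by
  simp [feetOn]

theorem idxOf_inj_of_mem {l : List V} {v w : V} (hv : v ∈ l) (h : l.idxOf v = l.idxOf w) :
    v = w := by
  exact (List.idxOf_inj hv).1 h

theorem eq_of_feet_before (hQ : ∀ i j v, v ∈ Q i → v ∈ Q j → i = j) {t : Fin N → ℕ}
    {i j j' : Fin N} {v v' : V} (hv : foot Q t j = some v) (hvi : v ∈ P i)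
    (hb : BeforeFeet P Q t i v) (hv' : foot Q t j' = some v') (hvi' : v' ∈ P i)
    (hb' : BeforeFeet P Q t i v') : j = j' := by
  have : v = v' := idxOf_inj_of_mem hvi (le_antisymm (hb _ _ hv' hvi') (hb' _ _ hv hvi))
  subst this
  exact hQ _ _ v (foot_mem Q hv) (foot_mem Q hv')

theorem eq_of_feet_after (hQ : ∀ i j v, v ∈ Q i → v ∈ Q j → i = j) {t : Fin N → ℕ}
    {i j j' : Fin N} {v v' : V} (hv : foot Q t j = some v) (hvi : v ∈ P i)
    (hb : AfterFeet P Q t i v) (hv' : foot Q t j' = some v') (hvi' : v' ∈ P i)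
    (hb' : AfterFeet P Q t i v') : j = j' := by
  have : v = v' := idxOf_inj_of_mem hvi (le_antisymm (hb' _ _ hv hvi) (hb _ _ hv' hvi'))
  subst this
  exact hQ _ _ v (foot_mem Q hv) (foot_mem Q hv')

/-- Of three extremal feet on one list, two would both be first or both be last, hence equal,
although the `Q j` are disjoint. -/
theorem card_feetOn_le_two (hQ : ∀ i j v, v ∈ Q i → v ∈ Q j → i = j)
    (hP : ∀ i j v, v ∈ P i → v ∈ P j → i = j) {t : Fin N → ℕ}
    (ht : ∀ j v, foot Q t j = some v →
      ∃ i, v ∈ P i ∧ (BeforeFeet P Q t i v ∨ AfterFeet P Q t i v)) (i : Fin N) :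
    (feetOn P Q t i).card ≤ 2 := by
  by_contra! hlt
  obtain ⟨a, b, c, ha, hb, hc, hab, hac, hbc⟩ := Finset.two_lt_card_iff.1 hlt
  obtain ⟨u, hu, hui⟩ := mem_feetOn.1 ha
  obtain ⟨v, hv, hvi⟩ := mem_feetOn.1 hb
  obtain ⟨w, hw, hwi⟩ := mem_feetOn.1 hc
  have ext : ∀ j v, foot Q t j = some v → v ∈ P i →
      BeforeFeet P Q t i v ∨ AfterFeet P Q t i v := by
    intro j v hv hvi
    obtain ⟨i', hi', h⟩ := ht j v hv
    rwa [hP i i' v hvi hi']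
  rcases ext _ _ hu hui with h1 | h1 <;> rcases ext _ _ hv hvi with h2 | h2 <;>
    rcases ext _ _ hw hwi with h3 | h3
  all_goals first
    | exact hab (eq_of_feet_before hQ hu hui h1 hv hvi h2)
    | exact hac (eq_of_feet_before hQ hu hui h1 hw hwi h3)
    | exact hbc (eq_of_feet_before hQ hv hvi h2 hw hwi h3)
    | exact hab (eq_of_feet_after hQ hu hui h1 hv hvi h2)
    | exact hac (eq_of_feet_after hQ hu hui h1 hw hwi h3)
    | exact hbc (eq_of_feet_after hQ hv hvi h2 hw hwi h3)

theorem exists_feet_of_card_eq_two {t : Fin N → ℕ} {i : Fin N}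
    (h : (feetOn P Q t i).card = 2) :
    (∃ j v, foot Q t j = some v ∧ v ∈ P i ∧ BeforeFeet P Q t i v) ∧
      ∃ j v, foot Q t j = some v ∧ v ∈ P i ∧ AfterFeet P Q t i v := by
  obtain ⟨a, b, -, hJ⟩ := Finset.card_eq_two.1 h
  obtain ⟨u, hu, hui⟩ := mem_feetOn.1 (show a ∈ feetOn P Q t i by simp [hJ])
  obtain ⟨v, hv, hvi⟩ := mem_feetOn.1 (show b ∈ feetOn P Q t i by simp [hJ])
  have only : ∀ j w, foot Q t j = some w → w ∈ P i → w = u ∨ w = v := by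
    intro j w hw hwi
    have : j ∈ feetOn P Q t i := mem_feetOn.2 ⟨w, hw, hwi⟩
    rw [hJ, Finset.mem_insert, Finset.mem_singleton] at this
    rcases this with rfl | rfl
    · exact Or.inl (Option.some.inj (hw.symm.trans hu))
    · exact Or.inr (Option.some.inj (hw.symm.trans hv))
  rcases le_total ((P i).idxOf u) ((P i).idxOf v) with hle | hle
  · refine ⟨⟨a, u, hu, hui, ?_⟩, ⟨b, v, hv, hvi, ?_⟩⟩ <;>
    · intro j w hw hwi
      rcases only j w hw hwi with rfl | rfl <;> omega
  · refine ⟨⟨b, v, hv, hvi, ?_⟩, ⟨a, u, hu, hui, ?_⟩⟩ <;>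
    · intro j w hw hwi
      rcases only j w hw hwi with rfl | rfl <;> omega

theorem not_before_and_after (hQ : ∀ i j v, v ∈ Q i → v ∈ Q j → i = j) {t : Fin N → ℕ}
    {i : Fin N} (h : (feetOn P Q t i).card = 2) {u : V} (h1 : BeforeFeet P Q t i u)
    (h2 : AfterFeet P Q t i u) : False := by
  obtain ⟨a, b, hab, hJ⟩ := Finset.card_eq_two.1 h
  obtain ⟨v, hv, hvi⟩ := mem_feetOn.1 (show a ∈ feetOn P Q t i by simp [hJ])
  obtain ⟨w, hw, hwi⟩ := mem_feetOn.1 (show b ∈ feetOn P Q t i by simp [hJ])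
  have e1 := le_antisymm (h1 _ _ hv hvi) (h2 _ _ hv hvi)
  have e2 := le_antisymm (h1 _ _ hw hwi) (h2 _ _ hw hwi)
  have : v = w := idxOf_inj_of_mem hvi (e1.symm.trans e2)
  subst this
  exact hab (hQ _ _ v (foot_mem Q hv) (foot_mem Q hw))

/-- If at most one foot is on `P i`, no vertex passed before is on `P i`. -/
theorem PassedBetween.not_mem {t : Fin N → ℕ} (h : PassedBetween P Q t) {i : Fin N}
    (hi : (feetOn P Q t i).card ≤ 1) {j : Fin N} {s : ℕ} {v : V} (hs : s < t j)
    (hv : (Q j)[s]? = some v) : v ∉ P i := by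
  intro hvi
  obtain ⟨h1, h2⟩ := h j s v i hs hv hvi
  simp only [BeforeFeet, AfterFeet, not_forall, not_le] at h1 h2
  obtain ⟨a, u, hu, hui, hlt⟩ := h1
  obtain ⟨b, w, hw, hwi, hlt'⟩ := h2
  have := Finset.card_le_one.1 hi a (mem_feetOn.2 ⟨u, hu, hui⟩) b (mem_feetOn.2 ⟨w, hw, hwi⟩)
  subst this
  rw [hu] at hw
  obtain rfl := Option.some.inj hw
  omega

/-- Each list that is not free has one foot, and that foot lies on exactly one `P i`. -/
theorem sum_card_feetOn (hP : ∀ i j v, v ∈ P i → v ∈ P j → i = j) {t : Fin N → ℕ}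
    (ht : ∀ j v, foot Q t j = some v → ∃ i, v ∈ P i) :
    ∑ i, (feetOn P Q t i).card + (freeLists Q t).card = N := by
  have hdisj : (↑(Finset.univ : Finset (Fin N)) : Set (Fin N)).PairwiseDisjoint
      (feetOn P Q t) := by
    intro i _ i' _ hne
    refine Finset.disjoint_left.2 fun j hj hj' => hne ?_
    obtain ⟨v, hv, hvi⟩ := mem_feetOn.1 hj
    obtain ⟨w, hw, hwi⟩ := mem_feetOn.1 hj'
    rw [hv] at hw
    obtain rfl := Option.some.inj hw
    exact hP _ _ _ hvi hwi
  rw [← Finset.card_biUnion hdisj]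
  have : Finset.univ.biUnion (feetOn P Q t) = (freeLists Q t)ᶜ := by
    ext j
    simp only [Finset.mem_biUnion, Finset.mem_univ, true_and, Finset.mem_compl, mem_feetOn,
      mem_freeLists]
    constructor
    · rintro ⟨i, v, hv, -⟩
      simp [hv]
    · intro h
      obtain ⟨v, hv⟩ := Option.ne_none_iff_exists'.1 h
      obtain ⟨i, hi⟩ := ht j v hv
      exact ⟨i, v, hv, hi⟩
  rw [this, Finset.card_compl_add_card, Fintype.card_fin]

/-- The lists `P i` with `n` feet. -/
def listsWith (P Q : Fin N → List V) (t : Fin N → ℕ) (n : ℕ) : Finset (Fin N) :=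
  {i | (feetOn P Q t i).card = n}

/-- Compared with `sum_card_feetOn`, the two counts show that the lists without feet are as many as
those with two feet and the free lists together. -/
theorem card_listsWith (h2 : ∀ i, (feetOn P Q t i).card ≤ 2) :
    (listsWith P Q t 0).card + (listsWith P Q t 1).card + (listsWith P Q t 2).card = N ∧
      ∑ i, (feetOn P Q t i).card =
        (listsWith P Q t 1).card + 2 * (listsWith P Q t 2).card := by
  constructor
  · have := Finset.card_eq_sum_card_fiberwise (s := (Finset.univ : Finset (Fin N)))
      (t := Finset.range 3) (f := fun i => (feetOn P Q t i).card)
      (fun i _ => by simpa using Nat.lt_succ_of_le (h2 i))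
    simp only [Finset.sum_range_succ, Finset.sum_range_zero, Finset.card_univ,
      Fintype.card_fin] at this
    simp only [listsWith]
    omega
  · have hpt : ∀ i, (feetOn P Q t i).card =
        (if (feetOn P Q t i).card = 1 then 1 else 0) +
          2 * (if (feetOn P Q t i).card = 2 then 1 else 0) := by
      intro i
      have := h2 i
      split_ifs <;> omega
    rw [Finset.sum_congr rfl fun i _ => hpt i, Finset.sum_add_distrib, ← Finset.mul_sum]
    simp [listsWith]

end Feet

/-! ### From disjoint resources to internally disjoint trees -/

section Packing

variable {W : Type*}

/-- The tree is a spanning tree of the component of `x` in `G`. -/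
theorem exists_tree_of_reachable {H G : SimpleGraph W} (hle : G ≤ H) {S : Finset W} {x : W}
    (hS : ∀ s ∈ S, G.Reachable x s) :
    ∃ T : H.Subgraph, IsSteinerTree S T ∧ (∀ a b, T.Adj a b → G.Adj a b) ∧
      ∀ v ∈ T.verts, G.Reachable x v := by
  classical
  let C : G.Subgraph := (G.connectedComponentMk x).toSubgraph
  have hv : ∀ v, v ∈ C.verts ↔ G.Reachable x v := by
    intro v
    change G.connectedComponentMk v = G.connectedComponentMk x ↔ _
    rw [SimpleGraph.ConnectedComponent.eq]
    exact ⟨fun h => h.symm, fun h => h.symm⟩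
  have hC : C.coe.Connected :=
    SimpleGraph.Subgraph.connected_iff'.1 (G.connectedComponentMk x).connected_toSubgraph
  obtain ⟨T₀, hT₀, htree⟩ := hC.exists_isTree_le
  let T : H.Subgraph :=
    { verts := C.verts
      Adj := fun a b => ∃ (ha : a ∈ C.verts) (hb : b ∈ C.verts), T₀.Adj ⟨a, ha⟩ ⟨b, hb⟩
      adj_sub := fun ⟨_, _, h⟩ => hle (C.adj_sub (hT₀ h))
      edge_vert := fun ⟨h, _, _⟩ => h
      symm := ⟨fun _ _ ⟨ha, hb, h⟩ => ⟨hb, ha, h.symm⟩⟩ }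
  have hcoe : T.coe = T₀ := by
    ext ⟨a, ha⟩ ⟨b, hb⟩
    constructor
    · rintro ⟨_, _, h⟩
      exact h
    · intro h
      exact ⟨ha, hb, h⟩
  refine ⟨T, ⟨hcoe ▸ htree, fun s hs => (hv s).2 (hS s hs)⟩, ?_, fun v h => (hv v).1 h⟩
  rintro a b ⟨_, _, h⟩
  exact C.adj_sub (hT₀ h)

/-- The subgraph of `H` that uses, besides the terminals in `S`, only the vertices and the edges
between terminals that belong to `K`. -/
def resourceGraph (H : SimpleGraph W) (S : Finset W) (K : Set (W ⊕ Sym2 W)) : SimpleGraph W where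
  Adj a b := H.Adj a b ∧ (a ∈ S ∨ .inl a ∈ K) ∧ (b ∈ S ∨ .inl b ∈ K) ∧
    (a ∈ S → b ∈ S → .inr s(a, b) ∈ K)
  symm := ⟨fun _ _ ⟨h, ha, hb, hab⟩ => ⟨h.symm, hb, ha, fun h1 h2 => Sym2.eq_swap ▸ hab h2 h1⟩⟩
  loopless := ⟨fun _ h => H.irrefl h.1⟩

theorem resourceGraph_le (H : SimpleGraph W) (S : Finset W) (K : Set (W ⊕ Sym2 W)) :
    resourceGraph H S K ≤ H := fun _ _ h => h.1

theorem resourceGraph_mono {H : SimpleGraph W} {S : Finset W} {K K' : Set (W ⊕ Sym2 W)}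
    (h : K ⊆ K') : resourceGraph H S K ≤ resourceGraph H S K' := by
  rintro a b ⟨hab, h1, h2, h3⟩
  exact ⟨hab, h1.imp_right fun h' => h h', h2.imp_right fun h' => h h', fun ha hb => h (h3 ha hb)⟩

/-- An edge either has an end outside `S` or joins two terminals. In both cases it consumes a
resource, so disjoint resources force edge-disjoint trees. -/
theorem card_le_generalizedLocalConnectivity [Finite W] {H : SimpleGraph W} {S : Finset W}
    {ι : Type*} [Fintype ι] (hcard : 1 < S.card) (K : ι → Set (W ⊕ Sym2 W))
    (hK : ∀ i j r, r ∈ K i → r ∈ K j → i = j)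
    (hconn : ∀ i, ∃ x, ∀ s ∈ S, (resourceGraph H S (K i)).Reachable x s) :
    Fintype.card ι ≤ generalizedLocalConnectivity H S := by
  classical
  have hsub : ∀ i, ∃ x ∈ S, ∀ s ∈ S, (resourceGraph H S (K i)).Reachable x s := by
    intro i
    obtain ⟨x, hx⟩ := hconn i
    obtain ⟨s₀, hs₀⟩ := Finset.card_pos.1 (by omega : 0 < S.card)
    exact ⟨s₀, hs₀, fun s hs => (hx s₀ hs₀).symm.trans (hx s hs)⟩
  choose x hxS hx using hsub
  choose T hT hadj hverts using fun i =>
    exists_tree_of_reachable (H := H) (resourceGraph_le H S (K i)) (hx i)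
  have hvert : ∀ i, ∀ v ∈ (T i).verts, v ∈ S ∨ .inl v ∈ K i := by
    intro i v hv
    by_cases hxv : x i = v
    · exact Or.inl (hxv ▸ hxS i)
    · obtain ⟨w⟩ := (hverts i v hv).symm
      cases w with
      | nil => exact absurd rfl hxv
      | cons h _ => exact h.2.1
  have hedge : ∀ i j a b, (T i).Adj a b → (T j).Adj a b → i = j := by
    intro i j a b hi hj
    have h1 := hadj i a b hi
    have h2 := hadj j a b hj
    by_cases ha : a ∈ S
    · by_cases hb : b ∈ S
      · exact hK i j _ (h1.2.2.2 ha hb) (h2.2.2.2 ha hb)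
      · exact hK i j _ (h1.2.2.1.resolve_left hb) (h2.2.2.1.resolve_left hb)
    · exact hK i j _ (h1.2.1.resolve_left ha) (h2.2.1.resolve_left ha)
  -- As `S` has two elements, every tree has an edge; edge-disjointness then makes different indices
  -- give different trees.
  have hne : ∀ i, ∃ a b, (T i).Adj a b := by
    intro i
    obtain ⟨a, b, ha, hb, hab⟩ := Finset.one_lt_card_iff.1 hcard
    have hpre : (T i).Preconnected := ⟨(hT i).1.connected.preconnected⟩
    have : Nontrivial (T i).verts := ⟨⟨a, (hT i).2 ha⟩, ⟨b, (hT i).2 hb⟩, by simpa using hab⟩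
    obtain ⟨w, hw⟩ := hpre.exists_adj_of_nontrivial ⟨a, (hT i).2 ha⟩
    exact ⟨a, w, hw⟩
  have hinj : Function.Injective T := by
    intro i j hij
    obtain ⟨a, b, h⟩ := hne i
    exact hedge i j a b h (hij ▸ h)
  refine le_csSup ?_ ⟨Finset.univ.image T, ?_, ?_, ?_⟩
  · have : Finite H.Subgraph := inferInstance
    have := Fintype.ofFinite H.Subgraph
    refine ⟨Fintype.card H.Subgraph, ?_⟩
    rintro m ⟨F, -, -, rfl⟩
    exact Finset.card_le_univ F
  · intro T' hT'
    obtain ⟨i, -, rfl⟩ := Finset.mem_image.1 hT'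
    exact hT i
  · intro T₁ h₁ T₂ h₂ hne
    obtain ⟨i, -, rfl⟩ := Finset.mem_image.1 (Finset.mem_coe.1 h₁)
    obtain ⟨j, -, rfl⟩ := Finset.mem_image.1 (Finset.mem_coe.1 h₂)
    have hij : i ≠ j := fun h => hne (h ▸ rfl)
    constructor
    · rw [Set.eq_empty_iff_forall_notMem]
      rintro e ⟨h1, h2⟩
      induction e with
      | _ a b => exact hij (hedge i j a b h1 h2)
    · ext v
      constructor
      · rintro ⟨h1, h2⟩
        by_contra hv
        exact hij (hK i j _ ((hvert i v h1).resolve_left hv) ((hvert j v h2).resolve_left hv))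
      · exact fun hv => ⟨(hT i).2 hv, (hT j).2 hv⟩
  · rw [Finset.card_image_of_injective _ hinj, Finset.card_univ]

/-- Numbering of a finite set by an initial segment of the naturals. -/
theorem exists_numbering {ι : Type*} (s : Finset ι) :
    ∃ f : ι → ℕ, ∀ n < s.card, ∃ a ∈ s, f a = n := by
  classical
  refine ⟨fun a => if h : a ∈ s then s.equivFin ⟨a, h⟩ else 0, fun n hn => ?_⟩
  refine ⟨s.equivFin.symm ⟨n, hn⟩, (s.equivFin.symm ⟨n, hn⟩).2, ?_⟩
  simp

/-- Disjoint connectors are combined into disjoint connectors of all three terminals: those in `T`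
are used alone, those in `A`, `B`, `C` connect two of the terminals and are used in pairs. -/
theorem le_generalizedLocalConnectivity_of_connectors [Finite W] {H : SimpleGraph W}
    {S : Finset W} {x y z : W} (hcard : 1 < S.card) (hS : ∀ s ∈ S, s = x ∨ s = y ∨ s = z)
    {ι : Type*} (K : ι → Set (W ⊕ Sym2 W))
    (hK : ∀ i j r, r ∈ K i → r ∈ K j → i = j) {T A B C : Finset ι} {c q : ℕ}
    (hTA : Disjoint T A) (hTB : Disjoint T B) (hTC : Disjoint T C) (hAB : Disjoint A B)
    (hAC : Disjoint A C) (hBC : Disjoint B C)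
    (hA : A.card = c + q) (hB : B.card = c + q) (hC : C.card = c)
    (hTconn : ∀ i ∈ T, (resourceGraph H S (K i)).Reachable x y ∧
      (resourceGraph H S (K i)).Reachable x z)
    (hAconn : ∀ i ∈ A, (resourceGraph H S (K i)).Reachable x y)
    (hBconn : ∀ i ∈ B, (resourceGraph H S (K i)).Reachable x z)
    (hCconn : ∀ i ∈ C, (resourceGraph H S (K i)).Reachable y z) :
    T.card + q + 3 * c / 2 ≤ generalizedLocalConnectivity H S := by
  classical
  obtain ⟨fT, hfT⟩ := exists_numbering T
  obtain ⟨fA, hfA⟩ := exists_numbering A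
  obtain ⟨fB, hfB⟩ := exists_numbering B
  obtain ⟨fC, hfC⟩ := exists_numbering C
  -- Apart from `q` extra pairs from `A` and `B`, there are `m` pairs from `A` and `B`, `h` from `A`
  -- and `C`, and `h` from `B` and `C`: `m + 2 * h = 3 * c / 2` in all. For odd `c` one element of
  -- `C` is left over.
  let m := (c + 1) / 2
  let h := c / 2
  have hmh : m + h = c := by omega
  -- The index of the tree that receives connector `i`. Surplus connectors may fall into any tree or
  -- out of range, since extra resources do no harm.
  let φ : ι → ℕ := fun i =>
    if i ∈ A then fA i
    else if i ∈ B then (if fB i < m then fB i else if fB i < c then c + q + (fB i - m) else fB i)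
    else if i ∈ C then (if fC i < h then m + fC i else c + q + (fC i - h))
    else c + q + h + fT i
  have φA : ∀ i ∈ A, φ i = fA i := fun i hi => by simp [φ, hi]
  have φB : ∀ i ∈ B, φ i =
      if fB i < m then fB i else if fB i < c then c + q + (fB i - m) else fB i := fun i hi => by
    simp only [φ, Finset.disjoint_right.1 hAB hi, hi, if_true, if_false]
  have φC : ∀ i ∈ C, φ i = if fC i < h then m + fC i else c + q + (fC i - h) := fun i hi => by
    simp only [φ, Finset.disjoint_right.1 hAC hi, Finset.disjoint_right.1 hBC hi, hi, if_true,
      if_false]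
  have φT : ∀ i ∈ T, φ i = c + q + h + fT i := fun i hi => by
    simp only [φ, Finset.disjoint_left.1 hTA hi, Finset.disjoint_left.1 hTB hi,
      Finset.disjoint_left.1 hTC hi, if_false]
  let KK : Fin (T.card + q + 3 * c / 2) → Set (W ⊕ Sym2 W) := fun n =>
    {r | ∃ i, φ i = n ∧ r ∈ K i}
  have hsub : ∀ (n : Fin (T.card + q + 3 * c / 2)) i, φ i = n → ∀ {a b : W},
      (resourceGraph H S (K i)).Reachable a b → (resourceGraph H S (KK n)).Reachable a b :=
    fun n i hi a b hab => hab.mono (resourceGraph_mono fun r hr => ⟨i, hi, hr⟩)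
  have key := card_le_generalizedLocalConnectivity (H := H) hcard KK ?_ ?_
  · simpa using key
  · rintro n n' r ⟨i, hi, hri⟩ ⟨j, hj, hrj⟩
    obtain rfl := hK i j r hri hrj
    exact Fin.ext (hi.symm.trans hj)
  · intro n
    have fin : ∀ {u v w : W}, (∀ s ∈ S, s = u ∨ s = v ∨ s = w) →
        (resourceGraph H S (KK n)).Reachable u v → (resourceGraph H S (KK n)).Reachable u w →
        ∃ x, ∀ s ∈ S, (resourceGraph H S (KK n)).Reachable x s := by
      intro u v w hs h1 h2
      refine ⟨u, fun s hsS => ?_⟩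
      rcases hs s hsS with rfl | rfl | rfl
      · exact SimpleGraph.Reachable.refl _
      · exact h1
      · exact h2
    have hn := n.2
    by_cases h1 : (n : ℕ) < c + q
    · obtain ⟨a, ha, han⟩ := hfA n (by omega)
      have ra := hsub n a ((φA a ha).trans han) (hAconn a ha)
      by_cases h2 : m ≤ n ∧ (n : ℕ) < c
      · obtain ⟨d, hd, hdn⟩ := hfC (n - m) (by omega)
        have rd := hsub n d (by rw [φC d hd, hdn, if_pos (by omega)]; omega) (hCconn d hd)
        exact fin hS ra (ra.trans rd)
      · obtain ⟨b, hb, hbn⟩ := hfB n (by omega)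
        have rb := hsub n b (by rw [φB b hb, hbn]; split_ifs <;> omega) (hBconn b hb)
        exact fin hS ra rb
    · by_cases h2 : (n : ℕ) < c + q + h
      · obtain ⟨b, hb, hbn⟩ := hfB (n - (c + q) + m) (by omega)
        obtain ⟨d, hd, hdn⟩ := hfC (n - (c + q) + h) (by omega)
        have rb := hsub n b (by rw [φB b hb, hbn]; split_ifs <;> omega) (hBconn b hb)
        have rd := hsub n d (by rw [φC d hd, hdn, if_neg (by omega)]; omega) (hCconn d hd)
        exact fin hS (rb.trans rd.symm) rb
      · obtain ⟨t, ht, htn⟩ := hfT (n - (c + q + h)) (by omega)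
        have e : φ t = n := by rw [φT t ht, htn]; omega
        exact fin hS (hsub n t e (hTconn t ht).1) (hsub n t e (hTconn t ht).2)

end Packing

/-! ### Connectors cut out of two path systems -/

section Connectors

variable {W : Type*}

/-- Only the start may be a terminal, so no edge between terminals is needed as a resource. -/
theorem resourceGraph_reachable_of_isChain {H : SimpleGraph W} {S : Finset W}
    {K : Set (W ⊕ Sym2 W)} {a : W} {l : List W} (h : (a :: l).IsChain H.Adj)
    (ha : a ∈ S ∨ .inl a ∈ K) (hl : ∀ v ∈ l, v ∉ S ∧ .inl v ∈ K) {b : W} (hb : b ∈ l) :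
    (resourceGraph H S K).Reachable a b := by
  induction l generalizing a with
  | nil => simp at hb
  | cons c l ih =>
    rw [List.isChain_cons_cons] at h
    have hc := hl c (by simp)
    have hac : (resourceGraph H S K).Reachable a c :=
      SimpleGraph.Adj.reachable (G := resourceGraph H S K)
        ⟨h.1, ha, Or.inr hc.2, fun _ h' => absurd h' hc.1⟩
    rcases List.mem_cons.1 hb with rfl | hb
    · exact hac
    · exact hac.trans (ih h.2 (Or.inr hc.2) (fun v hv => hl v (by simp [hv])) hb)

theorem isChain_reverse_adj {H : SimpleGraph W} {l : List W} (h : l.IsChain H.Adj) :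
    l.reverse.IsChain H.Adj := by
  rw [List.isChain_reverse]
  exact h.imp fun _ _ h => h.symm

/-- The vertices of the list `Q j` passed before its stopping position. -/
def passed {N : ℕ} (Q : Fin N → List W) (t : Fin N → ℕ) (j : Fin N) : Set W :=
  {v | ∃ s < t j, (Q j)[s]? = some v}

theorem eq_of_passed {N : ℕ} {Q : Fin N → List W}
    (hQ : ∀ i j v, v ∈ Q i → v ∈ Q j → i = j) {t : Fin N → ℕ} {j j' : Fin N} {v : W}
    (h : v ∈ passed Q t j) (h' : v ∈ passed Q t j') : j = j' := by
  obtain ⟨s, -, hs⟩ := h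
  obtain ⟨s', -, hs'⟩ := h'
  exact hQ _ _ v (List.mem_of_getElem? hs) (List.mem_of_getElem? hs')

variable [DecidableEq W]

/-- A system of `N` internally disjoint paths from `x` to `y`, given by the lists of their inner
vertices, that avoid `S`. -/
structure PathSystem (H : SimpleGraph W) (S : Finset W) (x y : W) (N : ℕ)
    (P : Fin N → List W) : Prop where
  isChain : ∀ i, (x :: P i ++ [y]).IsChain H.Adj
  notMem : ∀ i, ∀ v ∈ P i, v ∉ S
  nodup : ∀ i, (P i).Nodup
  disjoint : ∀ i j v, v ∈ P i → v ∈ P j → i = j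
  -- The empty list stands for the edge `xy`, which `disjoint` does not protect from repeated use.
  nil_unique : ∀ i j, P i = [] → P j = [] → i = j

namespace PathSystem

variable {H : SimpleGraph W} {S : Finset W} {x y : W} {N : ℕ} {P : Fin N → List W}

theorem reachable_left (hP : PathSystem H S x y N P) {K : Set (W ⊕ Sym2 W)} (hx : x ∈ S)
    {i : Fin N} {v : W} (hv : v ∈ P i)
    (hK : ∀ u ∈ P i, (P i).idxOf u ≤ (P i).idxOf v → .inl u ∈ K) :
    (resourceGraph H S K).Reachable x v := by
  have hlt := List.idxOf_lt_length_of_mem hv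
  have hc := hP.isChain i
  refine resourceGraph_reachable_of_isChain (l := (P i).take ((P i).idxOf v + 1)) ?_
    (Or.inl hx) ?_ ?_
  · have := (hc.take ((P i).idxOf v + 2))
    rw [List.cons_append, List.take_succ_cons, List.take_append_of_le_length (by omega)] at this
    exact this
  · intro u hu
    have hui := List.mem_of_mem_take hu
    refine ⟨hP.notMem i u hui, hK u hui ?_⟩
    obtain ⟨n, hn, rfl⟩ := List.mem_iff_getElem.1 hu
    rw [List.getElem_take, (hP.nodup i).idxOf_getElem]
    rw [List.length_take] at hn
    omega
  · rw [List.mem_take_iff_getElem]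
    exact ⟨(P i).idxOf v, by omega, List.getElem_idxOf hlt⟩

theorem reachable_right (hP : PathSystem H S x y N P) {K : Set (W ⊕ Sym2 W)} (hy : y ∈ S)
    {i : Fin N} {v : W} (hv : v ∈ P i)
    (hK : ∀ u ∈ P i, (P i).idxOf v ≤ (P i).idxOf u → .inl u ∈ K) :
    (resourceGraph H S K).Reachable y v := by
  have hlt := List.idxOf_lt_length_of_mem hv
  have hc := hP.isChain i
  refine resourceGraph_reachable_of_isChain (l := ((P i).drop ((P i).idxOf v)).reverse) ?_
    (Or.inl hy) ?_ ?_
  · have := isChain_reverse_adj (hc.drop ((P i).idxOf v + 1))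
    rw [List.cons_append, List.drop_succ_cons, List.drop_append_of_le_length (by omega),
      List.reverse_append] at this
    exact this
  · intro u hu
    rw [List.mem_reverse] at hu
    have hui := List.mem_of_mem_drop hu
    refine ⟨hP.notMem i u hui, hK u hui ?_⟩
    obtain ⟨n, hn, rfl⟩ := List.mem_iff_getElem.1 hu
    rw [List.getElem_drop, (hP.nodup i).idxOf_getElem]
    omega
  · rw [List.mem_reverse, List.mem_drop_iff_getElem]
    exact ⟨0, by omega, by simp⟩

theorem reachable (hP : PathSystem H S x y N P) {K : Set (W ⊕ Sym2 W)} (hx : x ∈ S)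
    (hy : y ∈ S) {i : Fin N} (hK : ∀ u ∈ P i, .inl u ∈ K)
    (hnil : P i = [] → .inr s(x, y) ∈ K) : (resourceGraph H S K).Reachable x y := by
  by_cases h : P i = []
  · have hc := hP.isChain i
    rw [h] at hc
    refine SimpleGraph.Adj.reachable (G := resourceGraph H S K)
      ⟨?_, Or.inl hx, Or.inl hy, fun _ _ => hnil h⟩
    simpa using hc
  · obtain ⟨v, hv⟩ := List.exists_mem_of_ne_nil _ h
    exact (hP.reachable_left hx hv fun u hu _ => hK u hu).trans
      (hP.reachable_right hy hv fun u hu _ => hK u hu).symm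

theorem reachable_foot {z : W} {Q : Fin N → List W} (hQ : PathSystem H S z x N Q)
    {t : Fin N → ℕ} {j : Fin N} {v : W} (hv : foot Q t j = some v) {K : Set (W ⊕ Sym2 W)}
    (hz : z ∈ S) (hvK : .inl v ∈ K) (hK : ∀ u ∈ passed Q t j, .inl u ∈ K) :
    (resourceGraph H S K).Reachable z v := by
  obtain ⟨hlt, hv'⟩ := List.getElem?_eq_some_iff.1 hv
  have hidx : (Q j).idxOf v = t j := by
    rw [← hv', (hQ.nodup j).idxOf_getElem]
  refine hQ.reachable_left hz (foot_mem Q hv) fun u hu hle => ?_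
  rw [hidx] at hle
  rcases hle.eq_or_lt with h | h
  · have : u = v := idxOf_inj_of_mem hu (h.trans hidx.symm)
    rwa [this]
  · refine hK u ⟨_, h, ?_⟩
    rw [List.getElem?_eq_getElem (List.idxOf_lt_length_of_mem hu), List.getElem_idxOf]

variable {z : W} {Q : Fin N → List W} {t : Fin N → ℕ}

/-- The vertices of `P i` that belong to the connector `p = (c, i)`: all of them (`c = 0`) if there
is at most one foot on `P i`, otherwise those up to the first foot (`c = 1`) and those from the last
foot on (`c = 2`). -/
def OwnsVertex (P Q : Fin N → List W) (t : Fin N → ℕ) (p : Fin 4 × Fin N) (v : W) : Prop :=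
  v ∈ P p.2 ∧ ((p.1 = 0 ∧ (feetOn P Q t p.2).card ≤ 1) ∨
    (p.1 = 1 ∧ (feetOn P Q t p.2).card = 2 ∧ BeforeFeet P Q t p.2 v) ∨
    (p.1 = 2 ∧ (feetOn P Q t p.2).card = 2 ∧ AfterFeet P Q t p.2 v))

/-- The vertices passed by `Q j` belong to the connector that owns its foot, or to the connector
`(3, j)` if there is no foot. -/
def OwnsLeg (P Q : Fin N → List W) (t : Fin N → ℕ) (p : Fin 4 × Fin N) (j : Fin N) : Prop :=
  (∃ v, foot Q t j = some v ∧ OwnsVertex P Q t p v) ∨ (foot Q t j = none ∧ p = (3, j))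

/-- The disjoint connectors cut out of two path systems by the stopping positions `t`. -/
inductive IsConnectorResource (x y z : W) (P Q : Fin N → List W) (t : Fin N → ℕ) :
    Fin 4 × Fin N → W ⊕ Sym2 W → Prop
  | vertex {p v} : OwnsVertex P Q t p v → IsConnectorResource x y z P Q t p (.inl v)
  | leg {p j v} : OwnsLeg P Q t p j → v ∈ passed Q t j →
      IsConnectorResource x y z P Q t p (.inl v)
  | pathEdge {i} : P i = [] → IsConnectorResource x y z P Q t (0, i) (.inr s(x, y))
  | freeEdge {j} : Q j = [] → IsConnectorResource x y z P Q t (3, j) (.inr s(z, x))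

theorem OwnsVertex.unique (hP : PathSystem H S x y N P) (hQ : PathSystem H S z x N Q)
    {p p' : Fin 4 × Fin N} {v : W} (h : OwnsVertex P Q t p v) (h' : OwnsVertex P Q t p' v) :
    p = p' := by
  obtain ⟨c, i⟩ := p
  obtain ⟨c', i'⟩ := p'
  obtain ⟨hv, h⟩ := h
  obtain ⟨hv', h'⟩ := h'
  obtain rfl : i = i' := hP.disjoint _ _ _ hv hv'
  dsimp only at h h'
  rcases h with ⟨rfl, h⟩ | ⟨rfl, h, hb⟩ | ⟨rfl, h, hb⟩ <;>
    rcases h' with ⟨rfl, h'⟩ | ⟨rfl, h', hb'⟩ | ⟨rfl, h', hb'⟩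
  all_goals first
    | rfl
    | omega
    | exact (not_before_and_after hQ.disjoint h hb hb').elim
    | exact (not_before_and_after hQ.disjoint h hb' hb).elim

theorem OwnsLeg.unique (hP : PathSystem H S x y N P) (hQ : PathSystem H S z x N Q)
    {p p' : Fin 4 × Fin N} {j : Fin N} (h : OwnsLeg P Q t p j) (h' : OwnsLeg P Q t p' j) :
    p = p' := by
  rcases h with ⟨v, hv, h⟩ | ⟨hv, h⟩ <;> rcases h' with ⟨v', hv', h'⟩ | ⟨hv', h'⟩
  · rw [hv] at hv'
    obtain rfl := Option.some.inj hv'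
    exact h.unique hP hQ h'
  · simp [hv] at hv'
  · simp [hv] at hv'
  · rw [h, h']

/-- Legs may cross a `P i` only strictly between its two feet, and that stretch is owned by no
connector. -/
theorem OwnsVertex.notMem_passed (ht : PassedBetween P Q t) {p : Fin 4 × Fin N} {v : W}
    (h : OwnsVertex P Q t p v) (j : Fin N) : v ∉ passed Q t j := by
  rintro ⟨s, hs, hsv⟩
  obtain ⟨hv, ⟨-, h⟩ | ⟨-, -, h⟩ | ⟨-, -, h⟩⟩ := h
  · exact ht.not_mem h hs hsv hv
  · exact (ht j s v _ hs hsv hv).1 h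
  · exact (ht j s v _ hs hsv hv).2 h

theorem IsConnectorResource.unique (hP : PathSystem H S x y N P) (hQ : PathSystem H S z x N Q)
    (ht : PassedBetween P Q t) (hyz : y ≠ z) {p p' : Fin 4 × Fin N} {r : W ⊕ Sym2 W}
    (h : IsConnectorResource x y z P Q t p r) (h' : IsConnectorResource x y z P Q t p' r) :
    p = p' := by
  have hne : s(z, x) ≠ s(x, y) := by
    intro he
    rcases Sym2.eq_iff.1 he with ⟨h1, h2⟩ | ⟨h1, -⟩
    · exact hyz (h2.symm.trans h1.symm)
    · exact hyz h1.symm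
  cases h with
  | vertex h =>
    cases h' with
    | vertex h' => exact h.unique hP hQ h'
    | leg _ h' => exact absurd h' (h.notMem_passed ht _)
  | leg h hv =>
    cases h' with
    | vertex h' => exact absurd hv (h'.notMem_passed ht _)
    | leg h' hv' =>
      obtain rfl := eq_of_passed hQ.disjoint hv hv'
      exact h.unique hP hQ h'
  | pathEdge h =>
    generalize hr : s(x, y) = e at h'
    cases h' with
    | pathEdge h' => rw [hP.nil_unique _ _ h h']
    | freeEdge h' => exact absurd hr.symm hne
  | freeEdge h =>
    generalize hr : s(z, x) = e at h'
    cases h' with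
    | pathEdge h' => exact absurd hr hne
    | freeEdge h' => rw [hQ.nil_unique _ _ h h']

/-- Two systems of `N` internally disjoint paths, from `x` to `y` and from `z` to `x`, yield many
internally disjoint trees through `x`, `y` and `z`. -/
theorem le_generalizedLocalConnectivity [Finite W] (hyz : y ≠ z) (hcard : 1 < S.card)
    (hS : ∀ s, s ∈ S ↔ s = x ∨ s = y ∨ s = z)
    (hP : PathSystem H S x y N P) (hQ : PathSystem H S z x N Q) :
    N - (N / 2 + 1) / 2 ≤ generalizedLocalConnectivity H S := by
  obtain ⟨t, ht, hext⟩ := exists_stopping P Q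
  have h2 := card_feetOn_le_two hQ.disjoint hP.disjoint hext
  have hsum := sum_card_feetOn hP.disjoint (fun j v h => (hext j v h).imp fun _ h => h.1)
  obtain ⟨hN, hsum'⟩ := card_listsWith h2
  have hxS : x ∈ S := (hS x).2 (by simp)
  have hyS : y ∈ S := (hS y).2 (by simp)
  have hzS : z ∈ S := (hS z).2 (by simp)
  let K : Fin 4 × Fin N → Set (W ⊕ Sym2 W) := fun p => {r | IsConnectorResource x y z P Q t p r}
  have foot_reach : ∀ p j v, foot Q t j = some v → OwnsVertex P Q t p v →
      (resourceGraph H S (K p)).Reachable z v := by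
    intro p j v hv h
    exact reachable_foot hQ hv hzS (.vertex h) fun u hu => .leg (Or.inl ⟨v, hv, h⟩) hu
  -- `T`: lists with one foot. `A`: lists without feet. `B`: beginnings of lists with two feet, and
  -- free lists. `C`: ends of lists with two feet.
  have key := le_generalizedLocalConnectivity_of_connectors (H := H) (x := x) (y := y) (z := z)
    (c := (listsWith P Q t 2).card) (q := (freeLists Q t).card) hcard
    (fun s hs => (hS s).1 hs) K (fun p p' r h h' => h.unique hP hQ ht hyz h')
    (T := ({0} : Finset (Fin 4)) ×ˢ listsWith P Q t 1)
    (A := ({0} : Finset (Fin 4)) ×ˢ listsWith P Q t 0)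
    (B := ({1} : Finset (Fin 4)) ×ˢ listsWith P Q t 2 ∪ ({3} : Finset (Fin 4)) ×ˢ freeLists Q t)
    (C := ({2} : Finset (Fin 4)) ×ˢ listsWith P Q t 2) ?_ ?_ ?_ ?_ ?_ ?_ ?_ ?_ ?_ ?_ ?_ ?_ ?_
  · rw [Finset.card_product, Finset.card_singleton, one_mul] at key
    -- With `c` lists having two feet the bound is `N - (c + 1) / 2`, and the counts give `2 * c ≤
    -- N`.
    omega
  · rw [Finset.disjoint_left]
    rintro ⟨c, i⟩ h h'
    simp only [Finset.mem_product, listsWith, Finset.mem_filter] at h h'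
    omega
  · rw [Finset.disjoint_left]
    rintro ⟨c, i⟩ h h'
    simp only [Finset.mem_product, Finset.mem_union, Finset.mem_singleton] at h h'
    omega
  · rw [Finset.disjoint_left]
    rintro ⟨c, i⟩ h h'
    simp only [Finset.mem_product, Finset.mem_singleton] at h h'
    omega
  · rw [Finset.disjoint_left]
    rintro ⟨c, i⟩ h h'
    simp only [Finset.mem_product, Finset.mem_union, Finset.mem_singleton] at h h'
    omega
  · rw [Finset.disjoint_left]
    rintro ⟨c, i⟩ h h'
    simp only [Finset.mem_product, Finset.mem_singleton] at h h'
    omega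
  · rw [Finset.disjoint_left]
    rintro ⟨c, i⟩ h h'
    simp only [Finset.mem_product, Finset.mem_union, Finset.mem_singleton] at h h'
    omega
  · rw [Finset.card_product, Finset.card_singleton, one_mul]
    omega
  · rw [Finset.card_union_of_disjoint, Finset.card_product, Finset.card_product,
      Finset.card_singleton, Finset.card_singleton, one_mul, one_mul]
    rw [Finset.disjoint_left]
    rintro ⟨c, i⟩ h h'
    simp only [Finset.mem_product, Finset.mem_singleton] at h h'
    omega
  · rw [Finset.card_product, Finset.card_singleton, one_mul]
  · rintro ⟨c, i⟩ h
    simp only [Finset.mem_product, Finset.mem_singleton, listsWith, Finset.mem_filter,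
      Finset.mem_univ, true_and] at h
    obtain ⟨rfl, h⟩ := h
    have own : ∀ u ∈ P i, OwnsVertex P Q t (0, i) u := fun u hu => ⟨hu, Or.inl ⟨rfl, h.le⟩⟩
    obtain ⟨j, hj⟩ := Finset.card_pos.1 (by omega : 0 < (feetOn P Q t i).card)
    obtain ⟨v, hv, hvi⟩ := mem_feetOn.1 hj
    have r1 := hP.reachable_left (K := K (0, i)) hxS hvi fun u hu _ => .vertex (own u hu)
    have r2 := hP.reachable_right (K := K (0, i)) hyS hvi fun u hu _ => .vertex (own u hu)
    exact ⟨r1.trans r2.symm, r1.trans (foot_reach _ j v hv (own v hvi)).symm⟩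
  · rintro ⟨c, i⟩ h
    simp only [Finset.mem_product, Finset.mem_singleton, listsWith, Finset.mem_filter,
      Finset.mem_univ, true_and] at h
    obtain ⟨rfl, h⟩ := h
    exact hP.reachable hxS hyS (fun u hu =>
      .vertex ⟨hu, Or.inl ⟨rfl, h.trans_le (Nat.zero_le 1)⟩⟩) .pathEdge
  · rintro ⟨c, i⟩ h
    simp only [Finset.mem_product, Finset.mem_union, Finset.mem_singleton, listsWith,
      Finset.mem_filter, Finset.mem_univ, true_and, mem_freeLists] at h
    rcases h with ⟨rfl, h⟩ | ⟨rfl, h⟩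
    · obtain ⟨⟨j, v, hv, hvi, hb⟩, -⟩ := exists_feet_of_card_eq_two h
      have own : ∀ u ∈ P i, (P i).idxOf u ≤ (P i).idxOf v → OwnsVertex P Q t (1, i) u :=
        fun u hu hle => ⟨hu, Or.inr (Or.inl ⟨rfl, h, fun j' w hw hwi =>
          hle.trans (hb j' w hw hwi)⟩)⟩
      have r1 := hP.reachable_left (K := K (1, i)) hxS hvi fun u hu hle => .vertex (own u hu hle)
      exact r1.trans (foot_reach _ j v hv (own v hvi le_rfl)).symm
    · refine (hQ.reachable hzS hxS (fun u hu => .leg (Or.inr ⟨h, rfl⟩) ?_) .freeEdge).symm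
      obtain ⟨n, hn, rfl⟩ := List.mem_iff_getElem.1 hu
      -- Having no foot means that the stopping position is beyond the end, so every vertex of the
      -- list is passed.
      have := List.getElem?_eq_none_iff.1 h
      exact ⟨n, by omega, List.getElem?_eq_getElem hn⟩
  · rintro ⟨c, i⟩ h
    simp only [Finset.mem_product, Finset.mem_singleton, listsWith,
      Finset.mem_filter, Finset.mem_univ, true_and] at h
    obtain ⟨rfl, h⟩ := h
    obtain ⟨-, j, v, hv, hvi, hb⟩ := exists_feet_of_card_eq_two h
    have own : ∀ u ∈ P i, (P i).idxOf v ≤ (P i).idxOf u → OwnsVertex P Q t (2, i) u :=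
      fun u hu hle => ⟨hu, Or.inr (Or.inr ⟨rfl, h, fun j' w hw hwi =>
        (hb j' w hw hwi).trans hle⟩)⟩
    have r1 := hP.reachable_right (K := K (2, i)) hyS hvi fun u hu hle => .vertex (own u hu hle)
    exact r1.trans (foot_reach _ j v hv (own v hvi le_rfl)).symm

end PathSystem

end Connectors

/-! ### From the absence of small separators to path systems -/

section Separation

variable {W : Type*}

/-- `a` and `b` are joined by a walk that avoids `X`. -/
def AvoidReach (H : SimpleGraph W) (X : Finset W) (a b : W) : Prop :=
  ∃ w : H.Walk a b, ∀ v ∈ w.support, v ∉ X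

/-- No set of less than `n` vertices separates two vertices outside of it. -/
def NoSmallSeparator (H : SimpleGraph W) (n : ℕ) : Prop :=
  ∀ X : Finset W, X.card < n → ∀ a b, a ∉ X → b ∉ X → AvoidReach H X a b

theorem AvoidReach.refl {H : SimpleGraph W} {X : Finset W} {a : W} (h : a ∉ X) :
    AvoidReach H X a a := ⟨.nil, by simpa using h⟩

theorem AvoidReach.symm {H : SimpleGraph W} {X : Finset W} {a b : W} (h : AvoidReach H X a b) :
    AvoidReach H X b a := by
  obtain ⟨w, hw⟩ := h
  exact ⟨w.reverse, by simpa using hw⟩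

theorem AvoidReach.trans {H : SimpleGraph W} {X : Finset W} {a b c : W}
    (h : AvoidReach H X a b) (h' : AvoidReach H X b c) : AvoidReach H X a c := by
  obtain ⟨w, hw⟩ := h
  obtain ⟨w', hw'⟩ := h'
  refine ⟨w.append w', fun v hv => ?_⟩
  rw [SimpleGraph.Walk.mem_support_append_iff] at hv
  exact hv.elim (hw v) (hw' v)

theorem AvoidReach.of_adj {H : SimpleGraph W} {X : Finset W} {a b : W}
    (h : H.Adj a b) (ha : a ∉ X) (hb : b ∉ X) : AvoidReach H X a b :=
  ⟨.cons h .nil, by simp [ha, hb]⟩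

theorem AvoidReach.right_notMem {H : SimpleGraph W} {X : Finset W} {a b : W}
    (h : AvoidReach H X a b) : b ∉ X := by
  obtain ⟨w, hw⟩ := h
  exact hw b w.end_mem_support

variable [Fintype W] [DecidableEq W]

open Classical in
/-- The arcs of `H` outside `S`. -/
noncomputable def arcsOutside (H : SimpleGraph W) (S : Finset W) : Finset (W × W) :=
  {p | H.Adj p.1 p.2 ∧ p.1 ∉ S ∧ p.2 ∉ S}

open Classical in
/-- The neighbours of `x` outside `S`. -/
noncomputable def nbrsOutside (H : SimpleGraph W) (S : Finset W) (x : W) : Finset W :=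
  {w | H.Adj x w ∧ w ∉ S}

theorem mem_arcsOutside {H : SimpleGraph W} {S : Finset W} {a b : W} :
    (a, b) ∈ arcsOutside H S ↔ H.Adj a b ∧ a ∉ S ∧ b ∉ S := by
  simp [arcsOutside]

theorem mem_nbrsOutside {H : SimpleGraph W} {S : Finset W} {x w : W} :
    w ∈ nbrsOutside H S x ↔ H.Adj x w ∧ w ∉ S := by
  simp [nbrsOutside]

theorem isLinkList_outside {H : SimpleGraph W} {S : Finset W} {x y : W} {l : List W}
    (h : IsLinkList (arcsOutside H S) (nbrsOutside H S x) (nbrsOutside H S y) l) :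
    (x :: l ++ [y]).IsChain H.Adj ∧ ∀ v ∈ l, v ∉ S := by
  obtain ⟨⟨a, ha, hhead⟩, ⟨b, hb, hlast⟩, hc⟩ := h
  rw [mem_nbrsOutside] at ha hb
  constructor
  · rw [List.cons_append, List.isChain_cons, List.isChain_append]
    refine ⟨?_, hc.imp fun u v huv => (mem_arcsOutside.1 huv).1, by simp, ?_⟩
    · intro c hc'
      rw [List.head?_append, hhead] at hc'
      simp only [Option.some_or, Option.mem_some_iff] at hc'
      exact hc' ▸ ha.1
    · intro u hu v hv
      rw [hlast] at hu
      simp only [Option.mem_some_iff, List.head?_cons] at hu hv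
      exact hu ▸ hv ▸ hb.1.symm
  · have haS := ha.2
    clear ha hlast
    induction l generalizing a with
    | nil => simp
    | cons c l ih =>
      simp only [List.head?_cons, Option.some.injEq] at hhead
      subst hhead
      intro v hv
      rcases List.mem_cons.1 hv with rfl | hv
      · exact haS
      · cases l with
        | nil => simp at hv
        | cons d l =>
          rw [List.isChain_cons_cons] at hc
          exact ih d rfl hc.2 (mem_arcsOutside.1 hc.1).2.2 v hv

theorem exists_isLinkList_outside {H : SimpleGraph W} {S : Finset W} {x y z w : W}
    (hS : ∀ s, s ∈ S ↔ s = x ∨ s = y ∨ s = z) {p : H.Walk w y} (hp : p.IsPath)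
    (hxw : H.Adj x w) (hwy : w ≠ y) (hx : x ∉ p.support) (hz : z ∉ p.support) :
    ∃ l, IsLinkList (arcsOutside H S) (nbrsOutside H S x) (nbrsOutside H S y) l ∧
      ∀ v ∈ l, v ∈ p.support ∧ v ∉ S := by
  have hsupp : p.support = p.support.dropLast ++ [y] := by
    conv_lhs => rw [← List.dropLast_append_getLast p.support_ne_nil]
    simp
  have hnd := hp.support_nodup
  have hc := p.isChain_adj_support
  rw [hsupp] at hnd hc
  have hmem : ∀ v ∈ p.support.dropLast, v ∈ p.support ∧ v ∉ S := by
    intro v hv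
    have hvp := List.dropLast_subset _ hv
    refine ⟨hvp, fun hvS => ?_⟩
    rcases (hS v).1 hvS with rfl | rfl | rfl
    · exact hx hvp
    · exact (List.nodup_append.1 hnd).2.2 v hv v (by simp) rfl
    · exact hz hvp
  have hhead : p.support.dropLast.head? = some w := by
    cases p with
    | nil => exact absurd rfl hwy
    | cons h q =>
      rw [SimpleGraph.Walk.support_cons, List.dropLast_cons_of_ne_nil q.support_ne_nil]
      rfl
  have hne : p.support.dropLast ≠ [] := by
    intro h
    rw [h] at hhead
    simp at hhead
  refine ⟨p.support.dropLast, ⟨⟨w, ?_, hhead⟩, ⟨_, ?_, List.getLast?_eq_some_getLast hne⟩, ?_⟩,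
    hmem⟩
  · exact mem_nbrsOutside.2 ⟨hxw, (hmem w (List.mem_of_mem_head? hhead)).2⟩
  · refine mem_nbrsOutside.2 ⟨?_, (hmem _ (List.getLast_mem hne)).2⟩
    rw [List.isChain_append] at hc
    exact (hc.2.2 _ (List.getLast?_eq_some_getLast hne) y (by simp)).symm
  · have h1 := (List.isChain_append.1 hc).1
    refine h1.imp_of_mem_imp fun a b ha hb hab => ?_
    exact mem_arcsOutside.2 ⟨hab, (hmem a ha).2, (hmem b hb).2⟩

/-- One vertex is lost to avoiding `z`, and one more to the edge `xy` when it exists, because the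
paths counted here must have inner vertices. -/
theorem NoSmallSeparator.le_card {H : SimpleGraph W} {n : ℕ} (hH : NoSmallSeparator H n)
    (hn : n < Fintype.card W) {S X : Finset W} {x y z : W} [Decidable (H.Adj x y)]
    (hS : ∀ s, s ∈ S ↔ s = x ∨ s = y ∨ s = z) (hxy : x ≠ y) (hxz : x ≠ z) (hyz : y ≠ z)
    (hX : Separates (arcsOutside H S) (nbrsOutside H S x) (nbrsOutside H S y) X) :
    n ≤ X.card + 1 + (if H.Adj x y then 1 else 0) := by
  by_contra! hlt
  let X' := insert z ((X.erase x).erase y)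
  have hX' : X'.card ≤ X.card + 1 :=
    (Finset.card_insert_le _ _).trans
      (Nat.succ_le_succ ((Finset.card_erase_le).trans Finset.card_erase_le))
  have hxX : x ∉ X' := by simp [X', hxz]
  have hyX : y ∉ X' := by simp [X', hyz]
  suffices ∃ (w : W) (p : H.Walk w y), p.IsPath ∧ H.Adj x w ∧ w ≠ y ∧ x ∉ p.support ∧
      ∀ v ∈ p.support, v ∉ X' by
    obtain ⟨w, p, hp, hxw, hwy, hx, hpX⟩ := this
    obtain ⟨l, hl, hlp⟩ := exists_isLinkList_outside hS hp hxw hwy hx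
      (fun hz => hpX z hz (by simp [X']))
    obtain ⟨v, hv, hvX⟩ := hX l hl
    obtain ⟨h1, h2⟩ := hlp v hv
    rw [hS] at h2
    push Not at h2
    exact hpX v h1 (by simp [X', hvX, h2])
  split_ifs at hlt with hadj
  -- To bypass the edge `xy`, take a third vertex `b`. A walk from `x` to `b` that avoids `y`
  -- supplies a first step `w ≠ y`, and `w` is joined to `y` by a walk that avoids `x`.
  · obtain ⟨b, hb⟩ : ∃ b, b ∉ insert x (insert y X') := by
      by_contra! hall
      have h1 := Finset.card_le_card (fun a _ => hall a : Finset.univ ⊆ insert x (insert y X'))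
      have h2 := Finset.card_insert_le x (insert y X')
      have h3 := Finset.card_insert_le y X'
      rw [Finset.card_univ] at h1
      omega
    simp only [Finset.mem_insert, not_or] at hb
    obtain ⟨w, hw⟩ := hH (insert y X') (by have := Finset.card_insert_le y X'; omega) x b
      (by simp [hxX, hxy]) (by simp [hb])
    cases w with
    | nil => exact absurd rfl hb.1
    | @cons _ w _ h q =>
      have hwX : w ∉ insert y X' := hw w (by simp)
      simp only [Finset.mem_insert, not_or] at hwX
      obtain ⟨p, hp⟩ := hH (insert x X') (by have := Finset.card_insert_le x X'; omega) w y
        (by simp [hwX, h.ne']) (by simp [hyX, hxy.symm])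
      have hp' : ∀ v ∈ p.bypass.support, v ∉ insert x X' := fun v hv =>
        hp v (p.support_bypass_subset_support hv)
      refine ⟨w, p.bypass, p.bypass_isPath, h, hwX.1, fun hx => hp' x hx (by simp), ?_⟩
      exact fun v hv hvX => hp' v hv (by simp [hvX])
  · obtain ⟨p, hp⟩ := hH X' (by omega) x y hxX hyX
    have hp' : ∀ v ∈ p.bypass.support, v ∉ X' := fun v hv =>
      hp v (p.support_bypass_subset_support hv)
    have hpath := p.bypass_isPath
    generalize p.bypass = q at hp' hpath
    cases q with
    | nil => exact absurd rfl hxy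
    | @cons _ w _ h q =>
      rw [SimpleGraph.Walk.cons_isPath_iff] at hpath
      refine ⟨w, q, hpath.1, h, ?_, hpath.2, fun v hv => hp' v (by simp [hv])⟩
      rintro rfl
      exact hadj h

/-- Three distinct vertices of a graph without separators of less than `n` vertices: two of them are
joined by `n - 1` internally disjoint paths that avoid the third. -/
theorem NoSmallSeparator.exists_pathSystem {H : SimpleGraph W} {n : ℕ}
    (hH : NoSmallSeparator H n) (hn : n < Fintype.card W) {S : Finset W} {x y z : W}
    (hS : ∀ s, s ∈ S ↔ s = x ∨ s = y ∨ s = z) (hxy : x ≠ y) (hxz : x ≠ z) (hyz : y ≠ z) :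
    ∃ P : Fin (n - 1) → List W, PathSystem H S x y (n - 1) P := by
  classical
  have hsep := fun X hX => hH.le_card hn (X := X) hS hxy hxz hyz hX
  by_cases hadj : H.Adj x y
  · simp only [hadj, if_true] at hsep
    obtain hn1 | ⟨m, rfl⟩ : n ≤ 1 ∨ ∃ m, n = m + 2 := by
      rcases le_or_gt n 1 with h | h
      · exact Or.inl h
      · exact Or.inr ⟨n - 2, by omega⟩
    · obtain h0 : n - 1 = 0 := by omega
      rw [h0]
      exact ⟨fun i => i.elim0, fun i => i.elim0, fun i => i.elim0, fun i => i.elim0,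
        fun i => i.elim0, fun i => i.elim0⟩
    · obtain ⟨P, hP, hd⟩ := menger _ _ _ m fun X hX => by have := hsep X hX; omega
      have hne : ∀ i, P i ≠ [] := by
        intro i hi
        obtain ⟨a, -, ha⟩ := (hP i).1.1
        simp [hi] at ha
      -- The edge `xy` itself, as the empty list, replaces the path lost to adjacency.
      refine ⟨Fin.cons [] P, ?_, ?_, ?_, ?_, ?_⟩
      · refine Fin.cases (by simpa using hadj) fun i => ?_
        exact (isLinkList_outside (hP i).1).1
      · refine Fin.cases (by simp) fun i => ?_
        exact (isLinkList_outside (hP i).1).2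
      · refine Fin.cases (by simp) fun i => ?_
        exact (hP i).2
      · refine Fin.cases (by simp) fun i => Fin.cases (by simp) fun j => ?_
        intro v hi hj
        rw [hd i j v hi hj]
      · refine Fin.cases (Fin.cases (fun _ _ => rfl) fun j _ h => absurd h (hne j)) fun i => ?_
        exact fun j h => absurd h (hne i)
  · simp only [hadj, if_false] at hsep
    obtain ⟨P, hP, hd⟩ := menger _ _ _ (n - 1) fun X hX => by have := hsep X hX; omega
    have hne : ∀ i, P i ≠ [] := by
      intro i hi
      obtain ⟨a, -, ha⟩ := (hP i).1.1
      simp [hi] at ha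
    exact ⟨P, fun i => (isLinkList_outside (hP i).1).1, fun i => (isLinkList_outside (hP i).1).2,
      fun i => (hP i).2, hd, fun i j h => absurd h (hne i)⟩

end Separation

/-! ### Vertex cuts, edge cuts and degrees in terms of the connectivity -/

section Graph

variable {V : Type*}

theorem bddAbove_pathSystems [Finite V] (G : SimpleGraph V) (x y : V) :
    BddAbove {m | ∃ P : Finset (G.Path x y),
      (P : Set (G.Path x y)).Pairwise PathsInternallyDisjoint ∧ P.card = m} := by
  classical
  have := Fintype.ofFinite V
  refine ⟨Fintype.card (G.Path x y), ?_⟩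
  rintro m ⟨P, -, rfl⟩
  exact Finset.card_le_univ P

theorem exists_paths_of_ne [Finite V] (G : SimpleGraph V) {x y : V} (hxy : x ≠ y) :
    ∃ P : Finset (G.Path x y), (P : Set (G.Path x y)).Pairwise PathsInternallyDisjoint ∧
      connectivity G ≤ P.card := by
  obtain ⟨P, hP, hcard⟩ := Nat.sSup_mem
    (s := {m | ∃ P : Finset (G.Path x y),
      (P : Set (G.Path x y)).Pairwise PathsInternallyDisjoint ∧ P.card = m})
    ⟨0, ∅, by simp, rfl⟩ (bddAbove_pathSystems G x y)
  exact ⟨P, hP, hcard ▸ Nat.sInf_le ⟨x, y, hxy, rfl⟩⟩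

/-- The easy half of Menger's theorem: internally disjoint paths that all meet `A` meet it in
different vertices. -/
theorem noSmallSeparator_connectivity [Finite V] {G : SimpleGraph V} :
    NoSmallSeparator G (connectivity G) := by
  classical
  intro A hA x y hx hy
  by_cases hxy : x = y
  · subst hxy
    exact .refl hx
  obtain ⟨P, hP, hcard⟩ := exists_paths_of_ne G hxy
  by_contra hno
  have hmeet : ∀ p : G.Path x y, ∃ v ∈ p.1.support, v ∈ A := by
    intro p
    by_contra! h
    exact hno ⟨p.1, h⟩
  choose f hf hfA using hmeet
  have := Finset.card_le_card_of_injOn f (s := P) (t := A) (fun p _ => hfA p) (by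
    intro p hp q hq hpq
    by_contra hne
    rcases hP hp hq hne (f p) (hf p) (hpq ▸ hf q) with h | h
    · exact hx (h ▸ hfA p)
    · exact hy (h ▸ hfA p))
  omega

theorem isPath_eq_of_mem_edges {G : SimpleGraph V} {x y : V} {p q : G.Walk x y} (hp : p.IsPath)
    (hq : q.IsPath) (hpe : s(x, y) ∈ p.edges) (hqe : s(x, y) ∈ q.edges) : p = q := by
  have key : ∀ r : G.Walk x y, r.IsPath → s(x, y) ∈ r.edges →
      ∃ h : G.Adj x y, r = .cons h .nil := by
    intro r hr hre
    cases r with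
    | nil => simp at hre
    | @cons _ v _ h r =>
      rw [SimpleGraph.Walk.cons_isPath_iff] at hr
      rw [SimpleGraph.Walk.edges_cons, List.mem_cons] at hre
      rcases hre with hre | hre
      · have hv : v = y := (Sym2.congr_right.1 hre).symm
        subst hv
        have hnil := SimpleGraph.Walk.isPath_iff_nil.1 hr.1
        exact ⟨h, by rw [SimpleGraph.Walk.eq_nil_iff_nil.2 hnil]⟩
      · exact absurd (r.fst_mem_support_of_mem_edges hre) hr.2
  obtain ⟨_, rfl⟩ := key p hp hpe
  obtain ⟨_, rfl⟩ := key q hq hqe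
  rfl

/-- Internally disjoint paths share no edge: the ends of a shared edge would have to be `x` and `y`,
and then both paths consist of this edge alone. -/
theorem exists_walk_avoiding_edges [Finite V] {G : SimpleGraph V} {F : Finset (Sym2 V)}
    (hF : F.card < connectivity G) (x y : V) : ∃ w : G.Walk x y, ∀ e ∈ w.edges, e ∉ F := by
  classical
  by_cases hxy : x = y
  · subst hxy
    exact ⟨.nil, by simp⟩
  obtain ⟨P, hP, hcard⟩ := exists_paths_of_ne G hxy
  by_contra! hno
  choose f hf hfF using fun p : G.Path x y => hno p.1
  have := Finset.card_le_card_of_injOn f (s := P) (t := F) (fun p _ => hfF p) (by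
    intro p hp q hq hpq
    by_contra hne
    have hd := hP hp hq hne
    have hfq : f p ∈ q.1.edges := hpq ▸ hf q
    have hfp := hf p
    apply hne
    apply Subtype.ext
    generalize f p = e at hfp hfq
    induction e with
    | _ a b =>
      have hab := (p.1.adj_of_mem_edges hfp).ne
      have ha := hd a (p.1.fst_mem_support_of_mem_edges hfp) (q.1.fst_mem_support_of_mem_edges hfq)
      have hb := hd b (p.1.snd_mem_support_of_mem_edges hfp) (q.1.snd_mem_support_of_mem_edges hfq)
      have he : s(a, b) = s(x, y) := by
        rcases ha with rfl | rfl <;> rcases hb with rfl | rfl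
        · exact absurd rfl hab
        · rfl
        · exact Sym2.eq_swap
        · exact absurd rfl hab
      rw [he] at hfp hfq
      exact isPath_eq_of_mem_edges p.2 q.2 hfp hfq)
  omega

variable [Fintype V] [Nontrivial V]

open Classical in
-- Removing all edges at `v` isolates it, so there are at least κ(G) of them.
theorem connectivity_le_card_neighbors (G : SimpleGraph V) (v : V) :
    connectivity G ≤ (Finset.univ.filter (G.Adj v)).card := by
  by_contra! hlt
  obtain ⟨w, hw⟩ := exists_ne v
  obtain ⟨p, hp⟩ := exists_walk_avoiding_edges
    (F := (Finset.univ.filter (G.Adj v)).image fun u => s(v, u))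
    (Finset.card_image_le.trans_lt hlt) v w
  cases p with
  | nil => exact hw rfl
  | @cons _ u _ h q =>
    exact hp s(v, u) (by simp) (Finset.mem_image.2 ⟨u, by simpa using h, rfl⟩)

end Graph

/-! ### Separators and trees in the total graph -/

section Total

variable {V : Type*} {G : SimpleGraph V} {X : Finset (V ⊕ G.edgeSet)}

/-- The edges of `G` among the elements `X` of the total graph. -/
noncomputable def removedEdges (X : Finset (V ⊕ G.edgeSet)) :
    Finset (Sym2 V) :=
  X.toRight.map (Function.Embedding.subtype _)

theorem mem_removedEdges {e : G.edgeSet} :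
    (e : Sym2 V) ∈ removedEdges X ↔ Sum.inr e ∈ X := by
  simp [removedEdges]

theorem avoidReach_edges_of_mem {e f : G.edgeSet} {u : V} (hu : u ∈ (e : Sym2 V))
    (hu' : u ∈ (f : Sym2 V)) (he : .inr e ∉ X) (hf : .inr f ∉ X) :
    AvoidReach (totalGraph G) X (.inr e) (.inr f) := by
  by_cases hef : e = f
  · subst hef
    exact .refl he
  · exact .of_adj (show G.lineGraph.Adj e f from
      SimpleGraph.lineGraph_adj_iff_exists.2 ⟨hef, u, hu, hu'⟩) he hf

theorem avoidReach_edge_vertex {e : G.edgeSet} {u : V} (hu : u ∈ (e : Sym2 V))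
    (he : .inr e ∉ X) (hX : .inl u ∉ X) : AvoidReach (totalGraph G) X (.inr e) (.inl u) :=
  .of_adj (H := totalGraph G) (show u ∈ (e : Sym2 V) from hu) he hX

theorem avoidReach_vertices {u w : V} (h : AvoidReach G X.toLeft u w) :
    AvoidReach (totalGraph G) X (.inl u) (.inl w) := by
  obtain ⟨p, hp⟩ := h
  induction p with
  | nil => exact .refl (by simpa using hp)
  | @cons a b c h p ih =>
    simp only [SimpleGraph.Walk.support_cons, List.mem_cons, forall_eq_or_imp,
      Finset.mem_toLeft] at hp
    have hab : (totalGraph G).Adj (.inl a) (.inl b) := h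
    refine (AvoidReach.of_adj hab hp.1 (hp.2 b p.start_mem_support)).trans (ih ?_)
    simpa using hp.2

theorem avoidReach_edges_of_walk {u w : V} (p : G.Walk u w)
    (hp : ∀ e ∈ p.edges, e ∉ removedEdges X) {e f : G.edgeSet} (hu : u ∈ (e : Sym2 V))
    (hw : w ∈ (f : Sym2 V)) (he : .inr e ∉ X) (hf : .inr f ∉ X) :
    AvoidReach (totalGraph G) X (.inr e) (.inr f) := by
  induction p generalizing e with
  | nil => exact avoidReach_edges_of_mem hu hw he hf
  | @cons a b c h p ih =>
    simp only [SimpleGraph.Walk.edges_cons, List.mem_cons, forall_eq_or_imp] at hp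
    let g : G.edgeSet := ⟨s(a, b), h⟩
    have hg : .inr g ∉ X := fun hg => hp.1 (mem_removedEdges.2 hg)
    exact (avoidReach_edges_of_mem (u := a) hu (by simp [g]) he hg).trans
      (ih hp.2 (by simp [g]) hw hg)

variable [Fintype V]

/-- Internally disjoint trees use different edges at each vertex of `S`. -/
theorem generalizedLocalConnectivity_le_card_neighbors {W : Type*} [Fintype W]
    (H : SimpleGraph W) {S : Finset W} {a : W} (ha : a ∈ S) (hS : 1 < S.card) {N : Finset W}
    (hN : ∀ w, H.Adj a w → w ∈ N) : generalizedLocalConnectivity H S ≤ N.card := by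
  classical
  refine csSup_le' ?_
  rintro m ⟨F, hF, hd, rfl⟩
  have : Nonempty W := ⟨a⟩
  have hnbr : ∀ T ∈ F, ∃ w, T.Adj a w := by
    intro T hT
    obtain ⟨b, hb, hba⟩ := Finset.exists_mem_ne hS a
    have haT := (hF T hT).2 ha
    have : Nontrivial T.verts := ⟨⟨a, haT⟩, ⟨b, (hF T hT).2 hb⟩, by simpa using hba.symm⟩
    have hpre : T.Preconnected := ⟨(hF T hT).1.connected.preconnected⟩
    exact hpre.exists_adj_of_nontrivial ⟨a, haT⟩
  choose! f hf using hnbr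
  refine Finset.card_le_card_of_injOn f (fun T hT => hN _ (hf T hT).adj_sub) ?_
  intro T hT T' hT' hTT'
  by_contra hne
  have h := (hd hT hT' hne).1
  have : s(a, f T) ∈ T.edgeSet ∩ T'.edgeSet := ⟨hf T hT, hTT' ▸ hf T' hT'⟩
  rw [h] at this
  exact this

theorem generalizedLocalConnectivity_totalGraph_le (G : SimpleGraph V) [DecidableRel G.Adj]
    {S : Finset (V ⊕ G.edgeSet)} (hS : 1 < S.card) {v : V} (hv : .inl v ∈ S) :
    generalizedLocalConnectivity (totalGraph G) S ≤ 2 * G.degree v := by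
  classical
  refine (generalizedLocalConnectivity_le_card_neighbors (totalGraph G) hv hS
    (N := (G.neighborFinset v).disjSum (Finset.univ.filter fun e : G.edgeSet =>
      v ∈ (e : Sym2 V))) ?_).trans ?_
  · rintro (w | e) h
    · simpa using (show G.Adj v w from h)
    · simpa using (show v ∈ (e : Sym2 V) from h)
  · rw [Finset.card_disjSum, G.card_neighborFinset_eq_degree, two_mul]
    refine Nat.add_le_add_left ?_ _
    rw [← G.card_incidenceFinset_eq_degree]
    refine Finset.card_le_card_of_injOn Subtype.val ?_ Subtype.val_injective.injOn
    intro e he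
    simp only [Finset.coe_filter, Finset.mem_univ, true_and, Set.mem_ofPred_eq] at he
    simpa [SimpleGraph.incidenceSet] using he

variable [Nontrivial V]

theorem exists_edge_notMem (hX : (removedEdges X).card < connectivity G) (v : V) :
    ∃ e : G.edgeSet, v ∈ (e : Sym2 V) ∧ .inr e ∉ X := by
  classical
  by_contra! h
  have h1 := connectivity_le_card_neighbors G v
  have := Finset.card_le_card_of_injOn (fun u => s(v, u)) (s := Finset.univ.filter (G.Adj v))
    (t := removedEdges X) (by
      intro u hu
      have hadj : G.Adj v u := by simpa using hu
      exact mem_removedEdges.2 (h ⟨s(v, u), hadj⟩ (by simp))) (by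
      intro a _ b _ hab
      exact Sym2.congr_right.1 hab)
  omega

/-- If less than `2 κ(G)` elements are removed, among them less than `κ(G)` vertices, then each
remaining edge is still joined to a remaining vertex. -/
theorem exists_vertex_avoidReach
    (hX : X.toLeft.card + (removedEdges X).card < 2 * connectivity G)
    (hA : X.toLeft.card < connectivity G) {e : G.edgeSet} (he : .inr e ∉ X) :
    ∃ v, .inl v ∉ X ∧ AvoidReach (totalGraph G) X (.inr e) (.inl v) := by
  classical
  by_contra! hno
  -- `D` collects the ends of all edges still joined to `e`. All of `D` has been removed, and so
  -- have all edges leaving `D`; counting these gives a contradiction.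
  let D : Finset V := {v | ∃ f : G.edgeSet, AvoidReach (totalGraph G) X (.inr e) (.inr f) ∧
    v ∈ (f : Sym2 V)}
  have hD : ∀ v, v ∈ D ↔ ∃ f : G.edgeSet,
      AvoidReach (totalGraph G) X (.inr e) (.inr f) ∧ v ∈ (f : Sym2 V) := by
    simp [D]
  have hDA : D ⊆ X.toLeft := by
    intro v hv
    obtain ⟨f, hf, hvf⟩ := (hD v).1 hv
    rw [Finset.mem_toLeft]
    by_contra hvX
    exact hno v hvX (hf.trans (avoidReach_edge_vertex hvf hf.right_notMem hvX))
  have hout : ∀ v ∈ D, ∀ w ∉ D, G.Adj v w → s(v, w) ∈ removedEdges X := by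
    intro v hv w hw hadj
    obtain ⟨f, hf, hvf⟩ := (hD v).1 hv
    by_contra hF
    have hg : .inr (⟨s(v, w), hadj⟩ : G.edgeSet) ∉ X := fun h => hF (mem_removedEdges.2 h)
    exact hw ((hD w).2 ⟨_, hf.trans (avoidReach_edges_of_mem hvf (by simp) hf.right_notMem hg),
      by simp⟩)
  have hD2 : 2 ≤ D.card := by
    obtain ⟨⟨a, b⟩, hab⟩ := e
    have hab : G.Adj a b := hab
    refine Finset.one_lt_card.2 ⟨a, ?_, b, ?_, hab.ne⟩ <;>
      exact (hD _).2 ⟨_, .refl he, by simp⟩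
  have hDle := Finset.card_le_card hDA
  -- At least κ(G) edges start at `v`, and at most |D| - 1 of them stay in `D`.
  have hdeg : ∀ v ∈ D, connectivity G + 1 - D.card ≤
      ((Finset.univ.filter (G.Adj v)) \ D).card := by
    intro v hv
    have h1 := connectivity_le_card_neighbors G v
    have h2 : (Finset.univ.filter (G.Adj v)) \ D =
        (Finset.univ.filter (G.Adj v)) \ (D.erase v) := by
      ext w
      simp only [Finset.mem_sdiff, Finset.mem_filter, Finset.mem_univ, true_and,
        Finset.mem_erase]
      constructor
      · rintro ⟨h, h'⟩
        exact ⟨h, fun h'' => h' h''.2⟩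
      · rintro ⟨h, h'⟩
        exact ⟨h, fun h'' => h' ⟨h.ne', h''⟩⟩
    rw [h2]
    have h3 := Finset.le_card_sdiff (D.erase v) (Finset.univ.filter (G.Adj v))
    rw [Finset.card_erase_of_mem hv] at h3
    omega
  have hcount : D.card * (connectivity G + 1 - D.card) ≤ (removedEdges X).card := by
    refine le_trans (b := (D.sigma fun v => (Finset.univ.filter (G.Adj v)) \ D).card) ?_ ?_
    · rw [Finset.card_sigma, ← smul_eq_mul]
      exact Finset.card_nsmul_le_sum _ _ _ hdeg
    · refine Finset.card_le_card_of_injOn (fun p => s(p.1, p.2)) ?_ ?_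
      · rintro ⟨v, w⟩ h
        simp only [Finset.coe_sigma, Set.mem_sigma_iff, Finset.mem_coe, Finset.mem_sdiff,
          Finset.mem_filter, Finset.mem_univ, true_and] at h
        exact hout v h.1 w h.2.2 h.2.1
      · rintro ⟨v, w⟩ h ⟨v', w'⟩ h' heq
        simp only [Finset.coe_sigma, Set.mem_sigma_iff, Finset.mem_coe, Finset.mem_sdiff] at h h'
        rcases Sym2.eq_iff.1 heq with ⟨h1, h2⟩ | ⟨h1, h2⟩
        · dsimp only at h1 h2
          subst h1 h2
          rfl
        · dsimp only at h1 h2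
          exact absurd (h1 ▸ h.1) h'.2.2
  -- With d = |D| ≥ 2 and κ(G) = d + 1 + c, at least d + d(c + 2) ≥ 3d + 2c ≥ 2κ(G) elements have
  -- been removed.
  obtain ⟨c, hc⟩ := Nat.exists_eq_add_of_le (show D.card + 1 ≤ connectivity G by omega)
  have e1 : connectivity G + 1 - D.card = c + 2 := by omega
  rw [e1] at hcount
  nlinarith [Nat.mul_le_mul_right c hD2]

/-- The total graph of `G` has no separator of less than `2 κ(G)` vertices. -/
theorem totalGraph_noSmallSeparator (G : SimpleGraph V) :
    NoSmallSeparator (totalGraph G) (2 * connectivity G) := by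
  intro X hX a b ha hb
  have hsum : X.toLeft.card + (removedEdges X).card = X.card := by
    rw [removedEdges, Finset.card_map, Finset.card_toLeft_add_card_toRight]
  by_cases hF : (removedEdges X).card < connectivity G
  · have toEdge : ∀ a, a ∉ X → ∃ e : G.edgeSet, .inr e ∉ X ∧
        AvoidReach (totalGraph G) X a (.inr e) := by
      rintro (v | e) ha
      · obtain ⟨e, hve, he⟩ := exists_edge_notMem hF v
        exact ⟨e, he, (avoidReach_edge_vertex hve he ha).symm⟩
      · exact ⟨e, ha, .refl ha⟩
    obtain ⟨e, he, hae⟩ := toEdge a ha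
    obtain ⟨f, hf, hbf⟩ := toEdge b hb
    obtain ⟨p, hp⟩ := exists_walk_avoiding_edges hF (e : Sym2 V).out.1 (f : Sym2 V).out.1
    exact (hae.trans (avoidReach_edges_of_walk p hp (Sym2.out_fst_mem _) (Sym2.out_fst_mem _)
      he hf)).trans hbf.symm
  · have hA : X.toLeft.card < connectivity G := by omega
    have toVertex : ∀ a, a ∉ X → ∃ v, .inl v ∉ X ∧
        AvoidReach (totalGraph G) X a (.inl v) := by
      rintro (v | e) ha
      · exact ⟨v, ha, .refl ha⟩
      · exact exists_vertex_avoidReach (by omega) hA ha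
    obtain ⟨u, hu, hau⟩ := toVertex a ha
    obtain ⟨w, hw, hbw⟩ := toVertex b hb
    have := noSmallSeparator_connectivity X.toLeft hA u w (by simpa using hu) (by simpa using hw)
    exact (hau.trans (avoidReach_vertices this)).trans hbw.symm

open Classical in
-- For any `v`, κ(G) ≤ deg(v), while deg(v) < |V| and deg(v) ≤ |E|.
theorem two_mul_connectivity_lt_card (G : SimpleGraph V) :
    2 * connectivity G < Fintype.card (V ⊕ G.edgeSet) := by
  obtain ⟨v⟩ := (inferInstance : Nonempty V)
  have h1 := connectivity_le_card_neighbors G v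
  have hV : (Finset.univ.filter (G.Adj v)).card < Fintype.card V := by
    refine Finset.card_lt_card (Finset.filter_ssubset.2 ⟨v, Finset.mem_univ v, G.irrefl⟩)
  have hE : (Finset.univ.filter (G.Adj v)).card ≤ Fintype.card G.edgeSet := by
    rw [← Set.toFinset_card]
    refine Finset.card_le_card_of_injOn (fun u => s(v, u)) ?_ ?_
    · intro u hu
      simpa using hu
    · intro a _ b _ hab
      exact Sym2.congr_right.1 hab
  rw [Fintype.card_sum]
  omega

theorem le_generalizedLocalConnectivity_totalGraph (G : SimpleGraph V)
    {S : Finset (V ⊕ G.edgeSet)} (hS : S.card = 3) :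
    (3 * connectivity G - 1) / 2 ≤ generalizedLocalConnectivity (totalGraph G) S := by
  classical
  obtain ⟨x, y, z, hxy, hxz, hyz, rfl⟩ := Finset.card_eq_three.1 hS
  have hmem : ∀ s, s ∈ ({x, y, z} : Finset (V ⊕ G.edgeSet)) ↔ s = x ∨ s = y ∨ s = z := by simp
  have hmem' : ∀ s, s ∈ ({x, y, z} : Finset (V ⊕ G.edgeSet)) ↔ s = z ∨ s = x ∨ s = y := by
    intro s; rw [hmem]; tauto
  have hH := totalGraph_noSmallSeparator G
  have hn := two_mul_connectivity_lt_card G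
  obtain ⟨P, hP⟩ := hH.exists_pathSystem hn hmem hxy hxz hyz
  obtain ⟨Q, hQ⟩ := hH.exists_pathSystem hn hmem' hxz.symm hyz.symm hxy
  have := PathSystem.le_generalizedLocalConnectivity hyz (by omega) hmem hP hQ
  -- Here N = 2κ(G) - 1, so N / 2 = κ(G) - 1 if κ(G) > 0, and the bound becomes 2κ(G) - 1 -
  -- ⌊κ(G)/2⌋.
  omega

end Total

end TotalGraphConn

theorem theorem4p3 {V : Type*} [Fintype V] [Nontrivial V] (G : SimpleGraph V)
    [DecidableRel G.Adj] (hG : G.Connected) :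
    ⌊(3 * (TotalGraphConn.connectivity G : ℚ) - 1) / 2⌋ ≤
        (TotalGraphConn.generalizedConnectivity 3 (TotalGraphConn.totalGraph G) : ℤ) ∧
      TotalGraphConn.generalizedConnectivity 3 (TotalGraphConn.totalGraph G) ≤
        2 * G.minDegree := by
  classical
  obtain ⟨v, hv⟩ := G.exists_minimal_degree_vertex
  obtain ⟨u, hu⟩ := hG.preconnected.exists_adj_of_nontrivial v
  -- An edge at `v` with both its ends: three vertices of the total graph, among them one of minimum
  -- degree in `G`. It also shows that the minimum defining κ₃ is attained.
  let S : Finset (V ⊕ G.edgeSet) := {.inl v, .inl u, .inr ⟨s(v, u), hu⟩}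
  have hS : S.card = 3 := Finset.card_eq_three.2
    ⟨_, _, _, by simpa using hu.ne, by simp, by simp, rfl⟩
  constructor
  · obtain ⟨S', hS', heq⟩ := Nat.sInf_mem (s := {m | ∃ S : Finset (V ⊕ G.edgeSet),
      S.card = 3 ∧ TotalGraphConn.generalizedLocalConnectivity (TotalGraphConn.totalGraph G) S =
        m}) ⟨_, S, hS, rfl⟩
    have hle := TotalGraphConn.le_generalizedLocalConnectivity_totalGraph G hS'
    rw [heq] at hle
    change _ ≤ TotalGraphConn.generalizedConnectivity 3 (TotalGraphConn.totalGraph G) at hle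
    refine Int.lt_add_one_iff.1 (Int.floor_lt.2 ?_)
    have h2 : 3 * TotalGraphConn.connectivity G - 1 <
        2 * (TotalGraphConn.generalizedConnectivity 3 (TotalGraphConn.totalGraph G) + 1) := by
      omega
    -- Moving the 1 to the other side removes the truncated subtraction before the cast to `ℚ`.
    have h3 : 3 * TotalGraphConn.connectivity G <
        2 * (TotalGraphConn.generalizedConnectivity 3 (TotalGraphConn.totalGraph G) + 1) + 1 := by
      omega
    have h4 : (3 * TotalGraphConn.connectivity G : ℚ) <
        2 * (TotalGraphConn.generalizedConnectivity 3 (TotalGraphConn.totalGraph G) + 1) + 1 := by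
      exact_mod_cast h3
    push_cast
    linarith
  · rw [hv]
    exact (Nat.sInf_le (s := {m | ∃ S : Finset (V ⊕ G.edgeSet),
      S.card = 3 ∧ TotalGraphConn.generalizedLocalConnectivity (TotalGraphConn.totalGraph G) S =
        m}) ⟨S, hS, rfl⟩).trans
      (TotalGraphConn.generalizedLocalConnectivity_totalGraph_le G (S := S) (by omega) (by simp [S]))
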